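/- Let $\mu$ be a probability measure on a measurable space $\mathcal X$, let $\|\cdot\|$ and $d_2$ be the norm and the distance of $\mathbb L_2(\mu)$, and let $\|\cdot\|_\infty$ be the norm of $\mathbb L_\infty(\mu)$. Let $\overline{\mathbb L}_2$ be the set of all $s\in\mathbb L_2(\mu)$ with $s\ge 0$ and $\int s\,d\mu=1$. For $s\in\overline{\mathbb L}_2$ let $\mathbb E_s$ be the expectation when $\boldsymbol X=(X_1,\dots,X_n)$ is an i.i.d. sample with density $s$ with respect to $\mu$, and for $z\ge 2$ put $Q_s(z)=\int_{\{s>z\}}(s-z)^2\,d\mu$. Write $a\vee b$ for $\max(a,b)$ and $d_2(s,S)=\inf_{t\in S}d_2(s,t)$ (equal to $+\infty$ if $S=\emptyset$). A set $S\subset\mathbb L_2(\mu)$ has a metric dimension bounded by $D\ge 0$ if for every $\eta>0$ there is a set $S_\eta\subset\mathbb L_2(\mu)$ such that every $t\in S$ has some $t'\in S_\eta$ with $d_2(t,t')\le\eta$, and such that, for all $x\ge 2$ and all $t\in\mathbb L_2(\mu)$, the open ball with centre $t$ and radius $x\eta$ contains at most $\exp(Dx^2)$ points of $S_\eta$. Theorem.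 There are constants $C(A,q)$, depending only on $A$ and $q$, and a universal constant $C$ such that the following holds. Let $\mu$ be as above, let $n\ge 2$, let $\{\overline S_m, m\in\mathcal M\}$ be a finite or countable family of subsets of $\mathbb L_2(\mu)$ with metric dimensions bounded respectively by $\overline D_m\ge 1/2$, and let $(\Delta_m)_{m\in\mathcal M}$ be real weights with $1\le\sum_{m\in\mathcal M}e^{-\Delta_m}=\Sigma<+\infty$. Then for each $A\ge 1$ there is an estimator $\tilde s_A=\tilde s_A(\boldsymbol X)$, that is, a (strongly) measurable function of $\boldsymbol X$ with values in $\mathbb L_2(\mu)$, such that for every $s\in\overline{\mathbb L}_2$ and every $q$ with $1\le q<2A/\log 2$, $$\mathbb E_s\left[\|s-\tilde s_A(\boldsymbol X)\|^q\right]\le C(A,q)\,\Sigma\,\inf_{z\ge 2}\,\inf_{m\in\mathcal M}\left[d_2^q(s,\overline S_m)+\left(\frac{z\,(\overline D_m\vee\Delta_m\vee\log z)}{n}\right)^{q/2}+[Q_s(z)]^{q/2}\right].$$ In particular, the estimator $\tilde s=\tilde s_1$ satisfies, for every $s\in\overline{\mathbb L}_2$ with $\|s\|_\infty<+\infty$,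 $$\mathbb E_s\left[\|s-\tilde s(\boldsymbol X)\|^2\right]\le C\,\Sigma\,\inf_{m\in\mathcal M}\left[d_2^2(s,\overline S_m)+n^{-1}\|s\|_\infty\left(\overline D_m\vee\Delta_m\vee\log\|s\|_\infty\right)\right].$$ -/

import Mathlib

open MeasureTheory
open scoped ENNReal NNReal

universe u v

namespace DensityEstimation

/-- `N` is an `η`-net for `S`: every point of `S` is within distance `η` of a point of `N`. The net
is a subset of the ambient metric space, not necessarily of `S`. -/
def IsNetFor {E : Type*} [MetricSpace E] (η : ℝ) (N S : Set E) : Prop :=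
  ∀ t ∈ S, ∃ t' ∈ N, dist t t' ≤ η

/-- The subset `S` of the metric space `E` has a metric dimension bounded by `D`: for every `η > 0`
there is an `η`-net `N` for `S` with `|N ∩ B(t, x η)| ≤ exp (D x ^ 2)` for all `x ≥ 2` and all
`t` in `E`, where `B(t, r)` is the open ball. -/
def HasMetricDimLE {E : Type*} [MetricSpace E] (S : Set E) (D : ℝ) : Prop :=
  0 ≤ D ∧ ∀ η : ℝ, 0 < η → ∃ N : Set E, IsNetFor η N S ∧
    ∀ x : ℝ, 2 ≤ x → ∀ t : E,
      (N ∩ Metric.ball t (x * η)).Finite ∧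
        ((N ∩ Metric.ball t (x * η)).ncard : ℝ) ≤ Real.exp (D * x ^ 2)

variable {X : Type u} [MeasurableSpace X]

/-- The set of probability densities with respect to `μ` that belong to `L²(μ)`. -/
def densitiesL2 (μ : Measure X) : Set (Lp ℝ 2 μ) :=
  {s | (∀ᵐ x ∂μ, 0 ≤ s x) ∧ ∫ x, s x ∂μ = 1}

/-- The distribution `s · μ` of one observation with density `s`. -/
noncomputable def obsLaw (μ : Measure X) (s : Lp ℝ 2 μ) : Measure X :=
  μ.withDensity fun x => ENNReal.ofReal (s x)

/-- The joint distribution of `n` independent observations with density `s`. -/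
noncomputable def sampleLaw (μ : Measure X) (n : ℕ) (s : Lp ℝ 2 μ) : Measure (Fin n → X) :=
  Measure.pi fun _ => obsLaw μ s

/-- The risk `E_s ‖s - est (X₁, …, Xₙ)‖ ^ q`, as an element of `[0, ∞]`; the norm is the one of
`L²(μ)`. -/
noncomputable def risk (μ : Measure X) (n : ℕ) (q : ℝ) (s : Lp ℝ 2 μ)
    (est : (Fin n → X) → Lp ℝ 2 μ) : ℝ≥0∞ :=
  ∫⁻ ω, ‖s - est ω‖ₑ ^ q ∂(sampleLaw μ n s)

/-- `Q_s(z) = ∫_{s > z} (s - z)² dμ`. -/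
noncomputable def tailQ (μ : Measure X) (s : Lp ℝ 2 μ) (z : ℝ) : ℝ :=
  ∫ x in {x | z < s x}, (s x - z) ^ 2 ∂μ

/-- The essential supremum norm `‖s‖_∞` with respect to `μ`, meaningful when `s` belongs to
`L^∞(μ)`. -/
noncomputable def supNorm (μ : Measure X) (s : Lp ℝ 2 μ) : ℝ :=
  (eLpNorm s ∞ μ).toReal

end DensityEstimation

/-! Up to sampling noise, `‖F‖² - 2 · (empirical mean of F)` estimates `‖s - F‖² - ‖s‖²`. Comparing
two candidates that differ by a function `h` with `|h| ≤ b`, the noise has variance governed by `∫ s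
h² dμ`. Even for unbounded `s` this is at most `b (3/2 ‖h‖² + 1/2 Q_s(b))`. A Bernstein argument
therefore pays a small fraction of `‖h‖²`, absorbed by the loss, plus `Q_s(b)`, and leaves an
exponential tail at scale `b / n` (`lintegral_excess_rpow_le`). Summing the moments of these tails
over a countable family gives an oracle inequality for penalised least squares
(`lintegral_selection_le`).

This is applied twice, on two independent parts of the sample. On the first part the level `z` is
fixed and the candidates are points of nets of the models, truncated to `[0, z]`. The metric
dimension bounds the number of net points near any centre, so a Gaussian sum over each net is at
most `3 exp (8 D)`; the weights `Δ` pay for the union over models (`exists_level_estimator`). On the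
second part one of the levels `2 ^ (i + 1)` is chosen. Given the first part the candidates are
deterministic, so the same inequality applies (`exists_level_selection`). With `q = 2 p` and a
penalty proportional to `A (i + 1) 2 ^ (i + 1) / n`, the sum over levels is geometric of ratio `2 ^
p exp (-A)`, whence the condition `q < 2 A / log 2`. -/

namespace DensityEstimation

/-! ### Densities, tails, and an exponential moment inequality. -/

section Basics

variable {X : Type u} [MeasurableSpace X] {μ : Measure X}

lemma integral_obsLaw {s : Lp ℝ 2 μ} (hs : s ∈ densitiesL2 μ) (f : X → ℝ) :
    ∫ x, f x ∂(obsLaw μ s) = ∫ x, s x * f x ∂μ := by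
  have hm : AEMeasurable (fun x => ENNReal.ofReal (s x)) μ :=
    (Lp.stronglyMeasurable s).measurable.ennreal_ofReal.aemeasurable
  rw [obsLaw, integral_withDensity_eq_integral_toReal_smul₀ hm (by simp)]
  refine integral_congr_ae ?_
  filter_upwards [hs.1] with x hx
  simp [ENNReal.toReal_ofReal hx]

lemma integrable_density [IsFiniteMeasure μ] (s : Lp ℝ 2 μ) : Integrable s μ :=
  (Lp.memLp s).integrable (by norm_num)

lemma isProbabilityMeasure_obsLaw [IsFiniteMeasure μ] {s : Lp ℝ 2 μ} (hs : s ∈ densitiesL2 μ) :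
    IsProbabilityMeasure (obsLaw μ s) := by
  constructor
  rw [obsLaw, withDensity_apply _ MeasurableSet.univ, Measure.restrict_univ,
    ← ofReal_integral_eq_lintegral_ofReal (integrable_density s) hs.1, hs.2, ENNReal.ofReal_one]

lemma tailQ_nonneg (s : Lp ℝ 2 μ) (z : ℝ) : 0 ≤ tailQ μ s z :=
  integral_nonneg fun _ => sq_nonneg _

lemma tailQ_eq (s : Lp ℝ 2 μ) (z : ℝ) : tailQ μ s z = ∫ x, (max (s x - z) 0) ^ 2 ∂μ := by
  rw [tailQ, ← integral_indicator
    (measurableSet_lt measurable_const (Lp.stronglyMeasurable s).measurable)]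
  refine integral_congr_ae (Filter.Eventually.of_forall fun x => ?_)
  by_cases h : z < s x
  · simp [Set.indicator, h, max_eq_left (sub_nonneg.2 h.le)]
  · simp [Set.indicator, h, max_eq_right (sub_nonpos.2 (not_lt.1 h))]

lemma memLp_tail [IsFiniteMeasure μ] (s : Lp ℝ 2 μ) (z : ℝ) :
    MemLp (fun x => max (s x - z) 0) 2 μ :=
  ((Lp.memLp s).sub (memLp_const z)).pos_part

lemma integrable_tail_sq [IsFiniteMeasure μ] (s : Lp ℝ 2 μ) (z : ℝ) :
    Integrable (fun x => (max (s x - z) 0) ^ 2) μ :=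
  (memLp_tail s z).integrable_sq

lemma tailQ_anti [IsFiniteMeasure μ] (s : Lp ℝ 2 μ) {z z' : ℝ} (h : z ≤ z') :
    tailQ μ s z' ≤ tailQ μ s z := by
  rw [tailQ_eq, tailQ_eq]
  refine integral_mono (integrable_tail_sq s z') (integrable_tail_sq s z) fun x => ?_
  have : max (s x - z') 0 ≤ max (s x - z) 0 := max_le_max (by linarith) le_rfl
  exact pow_le_pow_left₀ (le_max_right _ _) this 2

lemma norm_sq_eq_integral (f : Lp ℝ 2 μ) : ‖f‖ ^ 2 = ∫ x, f x ^ 2 ∂μ := by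
  rw [← real_inner_self_eq_norm_sq, L2.inner_def]
  refine integral_congr_ae (Filter.Eventually.of_forall fun x => ?_)
  simp [sq]

/-- Split `s ≤ b + (s - b)₊`. Against the excess `(s - b)₊`, trade one factor `|h|` for `b` and
apply `2xy ≤ x² + y²` to the rest. Integrated, this is the variance bound that tolerates an
unbounded density. -/
lemma mul_sq_le_of_abs_le {h s b : ℝ} (hb : 0 ≤ b) (hh : |h| ≤ b) :
    s * h ^ 2 ≤ b * (3 / 2 * h ^ 2 + 1 / 2 * (max (s - b) 0) ^ 2) := by
  have h2 : h ^ 2 ≤ b * |h| := by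
    rw [← sq_abs]; nlinarith [abs_nonneg h]
  have h3 : s ≤ b + max (s - b) 0 := by linarith [le_max_left (s - b) 0]
  set t := max (s - b) 0
  have ht : 0 ≤ t := le_max_right _ _
  have h4 : s * h ^ 2 ≤ b * h ^ 2 + t * (b * |h|) := by
    nlinarith [mul_le_mul_of_nonneg_right h3 (sq_nonneg h), mul_le_mul_of_nonneg_left h2 ht]
  have h5 : t * |h| ≤ 1 / 2 * h ^ 2 + 1 / 2 * t ^ 2 := by
    rw [← sq_abs h]; nlinarith [sq_nonneg (t - |h|)]
  nlinarith [mul_le_mul_of_nonneg_left h5 hb]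

lemma integrable_of_bound {Y : Type*} [MeasurableSpace Y] {ν : Measure Y} [IsFiniteMeasure ν]
    {f : Y → ℝ} (hf : Measurable f) (b : ℝ) (hb : ∀ x, |f x| ≤ b) : Integrable f ν :=
  Integrable.of_bound hf.aestronglyMeasurable b (Filter.Eventually.of_forall hb)

/-- Bernstein type bound on the Laplace transform of a bounded function under `s · μ`, where the
variance is controlled by the `L²(μ)` norm and the tail of `s`. -/
lemma integral_exp_obsLaw_le [IsFiniteMeasure μ] {s : Lp ℝ 2 μ} (hs : s ∈ densitiesL2 μ)
    {h : X → ℝ} (hm : Measurable h) {H : Lp ℝ 2 μ} (hH : H =ᵐ[μ] h) {b : ℝ} (hb : 0 < b)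
    (hbd : ∀ x, |h x| ≤ b) :
    ∫ x, Real.exp (h x / (16 * b)) ∂(obsLaw μ s) ≤
      Real.exp (inner ℝ H s / (16 * b) + (3 / 2 * ‖H‖ ^ 2 + 1 / 2 * tailQ μ s b) / (256 * b)) := by
  have := isProbabilityMeasure_obsLaw hs
  have hq : ∀ x, |h x / (16 * b)| ≤ 1 := fun x => by
    rw [abs_div, abs_of_pos (by positivity : 0 < 16 * b), div_le_one (by positivity)]
    linarith [hbd x]
  have hi1 : Integrable h (obsLaw μ s) := integrable_of_bound hm b hbd
  have hi2 : Integrable (fun x => h x ^ 2) (obsLaw μ s) :=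
    integrable_of_bound (hm.pow_const 2) (b ^ 2) fun x => by
      rw [abs_pow]; exact pow_le_pow_left₀ (abs_nonneg _) (hbd x) 2
  have hi3 : Integrable (fun x => 1 + h x / (16 * b)) (obsLaw μ s) :=
    (integrable_const 1).add (hi1.div_const _)
  have hi4 : Integrable (fun x => (1 / (256 * b ^ 2)) * h x ^ 2) (obsLaw μ s) := hi2.const_mul _
  have e1 : ∫ x, h x ∂(obsLaw μ s) = inner ℝ H s := by
    rw [integral_obsLaw hs, L2.inner_def]
    refine integral_congr_ae ?_
    filter_upwards [hH] with x hx
    simp [hx]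
  have e2 : ∫ x, h x ^ 2 ∂(obsLaw μ s) ≤ b * (3 / 2 * ‖H‖ ^ 2 + 1 / 2 * tailQ μ s b) := by
    have hh : MemLp h 2 μ := (memLp_congr_ae hH).1 (Lp.memLp H)
    have hi5 : Integrable (fun x => b * (3 / 2 * h x ^ 2 + 1 / 2 * (max (s x - b) 0) ^ 2)) μ :=
      ((hh.integrable_sq.const_mul _).add ((integrable_tail_sq s b).const_mul _)).const_mul _
    have : b * (3 / 2 * ‖H‖ ^ 2 + 1 / 2 * tailQ μ s b) =
        ∫ x, b * (3 / 2 * h x ^ 2 + 1 / 2 * (max (s x - b) 0) ^ 2) ∂μ := by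
      rw [integral_const_mul, integral_add (hh.integrable_sq.const_mul _)
        ((integrable_tail_sq s b).const_mul _), integral_const_mul, integral_const_mul,
        ← tailQ_eq, norm_sq_eq_integral]
      congr 3
      exact integral_congr_ae (hH.fun_comp (fun y : ℝ => y ^ 2))
    rw [this, integral_obsLaw hs]
    refine integral_mono_of_nonneg ?_ hi5 ?_
    · filter_upwards [hs.1] with x hx
      exact mul_nonneg hx (sq_nonneg _)
    · exact Filter.Eventually.of_forall fun x => mul_sq_le_of_abs_le hb.le (hbd x)
  calc ∫ x, Real.exp (h x / (16 * b)) ∂(obsLaw μ s)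
      ≤ ∫ x, ((1 + h x / (16 * b)) + (1 / (256 * b ^ 2)) * h x ^ 2) ∂(obsLaw μ s) := by
        refine integral_mono_of_nonneg (Filter.Eventually.of_forall fun x => (Real.exp_pos _).le)
          (hi3.add hi4) (Filter.Eventually.of_forall fun x => ?_)
        -- `exp u ≤ 1 + u + u²` for `|u| ≤ 1`.
        have h1 := (abs_le.1 (Real.abs_exp_sub_one_sub_id_le (hq x))).2
        have h2 : (h x / (16 * b)) ^ 2 = (1 / (256 * b ^ 2)) * h x ^ 2 := by field_simp; norm_num
        simp only
        linarith
    _ = 1 + inner ℝ H s / (16 * b) + (1 / (256 * b ^ 2)) * ∫ x, h x ^ 2 ∂(obsLaw μ s) := by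
        rw [integral_add hi3 hi4, integral_add (integrable_const 1) (hi1.div_const _),
          integral_div, e1, integral_const_mul]
        simp
    _ ≤ 1 + inner ℝ H s / (16 * b) +
        (1 / (256 * b ^ 2)) * (b * (3 / 2 * ‖H‖ ^ 2 + 1 / 2 * tailQ μ s b)) := by gcongr
    _ = (inner ℝ H s / (16 * b) + (3 / 2 * ‖H‖ ^ 2 + 1 / 2 * tailQ μ s b) / (256 * b)) + 1 := by
        field_simp; ring
    _ ≤ _ := Real.add_one_le_exp _

/-- Raise `y / p ≤ exp (y / p)` to the power `p`. Moments of every order are thus controlled by a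
single Laplace transform. -/
lemma ofReal_rpow_le_exp {p : ℝ} (hp : 0 < p) (y : ℝ) :
    ENNReal.ofReal y ^ p ≤ ENNReal.ofReal (p ^ p * Real.exp y) := by
  rcases le_or_gt y 0 with hy | hy
  · rw [ENNReal.ofReal_of_nonpos hy, ENNReal.zero_rpow_of_pos hp]; exact zero_le
  · rw [ENNReal.ofReal_rpow_of_pos hy]
    refine ENNReal.ofReal_le_ofReal ?_
    have h1 : y / p ≤ Real.exp (y / p) := by linarith [Real.add_one_le_exp (y / p)]
    have h2 := Real.rpow_le_rpow (by positivity) h1 hp.le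
    rw [← Real.exp_mul, div_mul_cancel₀ _ hp.ne', Real.div_rpow hy.le hp.le,
      div_le_iff₀ (by positivity)] at h2
    linarith

end Basics

/-! ### Moments of the deviation of an empirical mean. -/

section Deviation

variable {X : Type u} [MeasurableSpace X] {μ : Measure X} {ι : Type*} [Fintype ι]

/-- The empirical mean of `f` over the sample `ω`. -/
noncomputable def empMean (f : X → ℝ) (ω : ι → X) : ℝ :=
  (∑ k, f (ω k)) / Fintype.card ι

/-- The deviation of the empirical mean of `h` from its expectation, from which a fraction of the
squared norm, the tail of the density and the weight `w` are subtracted. -/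
noncomputable def excess (s H : Lp ℝ 2 μ) (h : X → ℝ) (b w : ℝ) (ω : ι → X) : ℝ :=
  2 * (empMean h ω - inner ℝ H s) - 3 / 16 * ‖H‖ ^ 2 - 1 / 16 * tailQ μ s b - w

lemma lintegral_excess_rpow_le [IsFiniteMeasure μ] [Nonempty ι] {s : Lp ℝ 2 μ}
    (hs : s ∈ densitiesL2 μ)
    {h : X → ℝ} (hm : Measurable h) {H : Lp ℝ 2 μ} (hH : H =ᵐ[μ] h) {b : ℝ} (hb : 0 < b)
    (hbd : ∀ x, |h x| ≤ b) (w : ℝ) {p : ℝ} (hp : 0 < p) :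
    ∫⁻ ω : ι → X, ENNReal.ofReal (excess s H h b w ω) ^ p ∂(Measure.pi fun _ => obsLaw μ s) ≤
      ENNReal.ofReal (p ^ p * (32 * b / Fintype.card ι) ^ p *
        Real.exp (-(Fintype.card ι * w / (32 * b)))) := by
  have := isProbabilityMeasure_obsLaw hs
  set n : ℝ := (Fintype.card ι : ℝ) with hn
  have hn0 : 0 < n := by rw [hn]; exact_mod_cast Fintype.card_pos
  -- The scale of the tail. The coefficients `3/16` and `1/16` in `excess` are such that division by
  -- `c` turns the subtracted terms into exactly `n K`, which cancels the Laplace transform.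
  set c : ℝ := 32 * b / n with hc
  have hc0 : 0 < c := by positivity
  set K : ℝ := inner ℝ H s / (16 * b) + (3 / 2 * ‖H‖ ^ 2 + 1 / 2 * tailQ μ s b) / (256 * b)
    with hK
  have key : ∀ ω : ι → X, ENNReal.ofReal (excess s H h b w ω) ^ p ≤
      ENNReal.ofReal (c ^ p * p ^ p * Real.exp (-(n * w / (32 * b))) * Real.exp (-(n * K)) *
        ∏ k, Real.exp (h (ω k) / (16 * b))) := by
    intro ω
    have e : excess s H h b w ω = c * (excess s H h b w ω / c) := by field_simp
    have e' : excess s H h b w ω / c =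
        -(n * w / (32 * b)) + -(n * K) + ∑ k, h (ω k) / (16 * b) := by
      rw [← Finset.sum_div, excess, empMean, hc, hK, ← hn]
      field_simp
      ring
    rw [e, ENNReal.ofReal_mul hc0.le, ENNReal.mul_rpow_of_nonneg _ _ hp.le,
      ENNReal.ofReal_rpow_of_pos hc0]
    refine (mul_le_mul_right (ofReal_rpow_le_exp hp _) _).trans ?_
    rw [← ENNReal.ofReal_mul (by positivity), e', Real.exp_add, Real.exp_add, Real.exp_sum]
    apply le_of_eq
    ring_nf
  refine (lintegral_mono key).trans ?_
  have hmeas : Measurable fun x => Real.exp (h x / (16 * b)) :=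
    Real.measurable_exp.comp (hm.div_const _)
  have hint : Integrable (fun ω : ι → X => ∏ k, Real.exp (h (ω k) / (16 * b)))
      (Measure.pi fun _ => obsLaw μ s) := by
    refine Integrable.fintype_prod (f := fun _ x => Real.exp (h x / (16 * b))) fun _ => ?_
    refine integrable_of_bound hmeas (Real.exp 1) fun x => ?_
    rw [Real.abs_exp]
    refine Real.exp_le_exp.2 ?_
    rw [div_le_one (by positivity)]
    linarith [(abs_le.1 (hbd x)).2]
  rw [← ofReal_integral_eq_lintegral_ofReal (hint.const_mul _)
    (Filter.Eventually.of_forall fun ω => by positivity), integral_const_mul,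
    integral_fintype_prod_eq_pow (fun x => Real.exp (h x / (16 * b)))]
  refine ENNReal.ofReal_le_ofReal ?_
  have h1 := integral_exp_obsLaw_le hs hm hH hb hbd
  have h2 : (∫ x, Real.exp (h x / (16 * b)) ∂(obsLaw μ s)) ^ Fintype.card ι ≤
      Real.exp (n * K) := by
    rw [hn, Real.exp_nat_mul]
    exact pow_le_pow_left₀ (integral_nonneg fun _ => (Real.exp_pos _).le) h1 _
  calc _ ≤ c ^ p * p ^ p * Real.exp (-(n * w / (32 * b))) * Real.exp (-(n * K)) *
        Real.exp (n * K) := by gcongr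
    _ = _ := by
      rw [mul_assoc _ (Real.exp (-(n * K))), ← Real.exp_add]
      simp
      ring

end Deviation

/-- The infimum need not be attained, hence the slack `ε`; taking the least admissible index makes
the choice measurable. -/
lemma exists_measurable_approx_argmin {Ω : Type*} [MeasurableSpace Ω] {c : ℕ → Ω → ℝ}
    (hc : ∀ k, Measurable (c k)) (hbdd : ∀ ω, BddBelow (Set.range fun k => c k ω))
    {ε : ℝ} (hε : 0 < ε) :
    ∃ k : Ω → ℕ, Measurable k ∧ ∀ ω j, c (k ω) ω ≤ c j ω + ε := by
  classical
  have hex : ∀ ω, ∃ k, ∀ j, c k ω ≤ c j ω + ε := fun ω => by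
    obtain ⟨k, hk⟩ := exists_lt_of_ciInf_lt
      (show (⨅ k, c k ω) < (⨅ k, c k ω) + ε by linarith)
    exact ⟨k, fun j => hk.le.trans (by linarith [ciInf_le (hbdd ω) j])⟩
  refine ⟨fun ω => Nat.find (hex ω), measurable_find hex fun k => ?_, fun ω => Nat.find_spec (hex ω)⟩
  simp only [Set.ofPred_forall]
  exact MeasurableSet.iInter fun j => measurableSet_le (hc k) ((hc j).add_const ε)

lemma ennreal_add_rpow_le {p : ℝ} (hp : 0 ≤ p) (a b : ℝ≥0∞) :
    (a + b) ^ p ≤ 2 ^ p * (a ^ p + b ^ p) := by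
  have h : a + b ≤ 2 * max a b := by
    rw [two_mul]; exact add_le_add (le_max_left _ _) (le_max_right _ _)
  refine (ENNReal.rpow_le_rpow h hp).trans ?_
  rw [ENNReal.mul_rpow_of_nonneg _ _ hp]
  refine mul_le_mul_right ?_ _
  rcases max_choice a b with h | h <;> rw [h]
  · exact le_self_add
  · exact le_add_self

lemma empMean_sub {X ι : Type*} [Fintype ι] (f g : X → ℝ) (ω : ι → X) :
    empMean (fun x => f x - g x) ω = empMean f ω - empMean g ω := by
  simp [empMean, Finset.sum_sub_distrib, sub_div]

lemma empMean_le {X ι : Type*} [Fintype ι] {f : X → ℝ} {b : ℝ} (hb : 0 ≤ b) (h : ∀ x, f x ≤ b) (ω : ι → X) :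
    empMean f ω ≤ b := by
  rw [empMean]
  refine div_le_of_le_mul₀ (Nat.cast_nonneg _) hb ?_
  calc ∑ k, f (ω k) ≤ ∑ _k : ι, b := Finset.sum_le_sum fun k _ => h _
    _ = b * Fintype.card ι := by simp [mul_comm]

/-! ### Oracle inequality for penalised least squares. -/

section Selection

variable {X : Type u} [MeasurableSpace X] {μ : Measure X} {ι : Type*} [Fintype ι]

lemma enorm_rpow_two_mul {E : Type*} [SeminormedAddCommGroup E] (x : E) (p : ℝ) :
    ‖x‖ₑ ^ (2 * p) = ENNReal.ofReal (‖x‖ ^ 2) ^ p := by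
  rw [ENNReal.rpow_mul, ENNReal.ofReal_pow (norm_nonneg _), ofReal_norm]
  norm_num

lemma measurable_empMean {f : X → ℝ} (hf : Measurable f) :
    Measurable (empMean f : (ι → X) → ℝ) :=
  (Finset.measurable_sum _ fun k _ => hf.comp (measurable_pi_apply k)).div_const _

/-- The penalised least squares criterion. -/
noncomputable def crit (F : Lp ℝ 2 μ) (f : X → ℝ) (pen : ℝ) (ω : ι → X) : ℝ :=
  ‖F‖ ^ 2 - 2 * empMean f ω + pen

lemma measurable_crit (F : Lp ℝ 2 μ) {f : X → ℝ} (hf : Measurable f) (pen : ℝ) :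
    Measurable (crit F f pen : (ι → X) → ℝ) :=
  (((measurable_empMean hf).const_mul 2).const_sub _).add_const _

/-- The `3/16` of `excess` and the `1/16` allowed in `hw` add up to `1/4 ‖F - F₀‖²`, at most `1/2 ‖s
- F‖² + 1/2 ‖s - F₀‖²`. Half of the loss moves to the left, and doubling gives the constants. -/
lemma norm_sq_sub_le_of_crit_le {s F F₀ : Lp ℝ 2 μ} {f f₀ : X → ℝ} {pen pen₀ ε b w R Q : ℝ}
    {ω : ι → X} (hcrit : crit F f pen ω ≤ crit F₀ f₀ pen₀ ω + ε)
    (hw : w ≤ 1 / 16 * ‖F - F₀‖ ^ 2 + pen + R) (hQ : tailQ μ s b ≤ Q) :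
    ‖s - F‖ ^ 2 ≤ (3 * ‖s - F₀‖ ^ 2 + 2 * pen₀ + 2 * R + 2 * ε + Q) +
      2 * excess s (F - F₀) (fun x => f x - f₀ x) b w ω := by
  have h1 : ‖s - F‖ ^ 2 = ‖s‖ ^ 2 - 2 * inner ℝ F s + ‖F‖ ^ 2 := by
    rw [norm_sub_sq_real, real_inner_comm]
  have h2 : ‖s - F₀‖ ^ 2 = ‖s‖ ^ 2 - 2 * inner ℝ F₀ s + ‖F₀‖ ^ 2 := by
    rw [norm_sub_sq_real, real_inner_comm]
  have h3 : ‖F - F₀‖ ^ 2 ≤ 2 * ‖s - F‖ ^ 2 + 2 * ‖s - F₀‖ ^ 2 := by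
    have := norm_sub_le (s - F₀) (s - F)
    rw [sub_sub_sub_cancel_left] at this
    nlinarith [norm_nonneg (F - F₀), sq_nonneg (‖s - F₀‖ - ‖s - F‖)]
  have h4 := tailQ_nonneg s b
  rw [excess, empMean_sub, inner_sub_left]
  unfold crit at hcrit
  linarith

/-- Moment bound for the risk of an approximate minimiser of a penalised least squares criterion
over a countable family of bounded functions. -/
lemma lintegral_selection_le [IsFiniteMeasure μ] [Nonempty ι] {s : Lp ℝ 2 μ}
    (hs : s ∈ densitiesL2 μ) {J : Type*} [Countable J] {G : J → Lp ℝ 2 μ} {g : J → X → ℝ}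
    (hg : ∀ j, Measurable (g j)) (hG : ∀ j, G j =ᵐ[μ] g j) {pen b w : J → ℝ} {R ε Q : ℝ} (j₀ : J)
    (hb : ∀ j, 0 < b j) (hbd : ∀ j x, |g j x - g j₀ x| ≤ b j)
    (hQ : ∀ j, tailQ μ s (b j) ≤ Q)
    (hw : ∀ j, w j ≤ 1 / 16 * ‖G j - G j₀‖ ^ 2 + pen j + R)
    {sel : (ι → X) → J}
    (hsel : ∀ ω, crit (G (sel ω)) (g (sel ω)) (pen (sel ω)) ω ≤
      crit (G j₀) (g j₀) (pen j₀) ω + ε) {p : ℝ} (hp : 0 < p) :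
    ∫⁻ ω : ι → X, ‖s - G (sel ω)‖ₑ ^ (2 * p) ∂(Measure.pi fun _ => obsLaw μ s) ≤
      2 ^ p * (ENNReal.ofReal (3 * ‖s - G j₀‖ ^ 2 + 2 * pen j₀ + 2 * R + 2 * ε + Q) ^ p +
        2 ^ p * ∑' j, ENNReal.ofReal (p ^ p * (32 * b j / Fintype.card ι) ^ p *
          Real.exp (-(Fintype.card ι * w j / (32 * b j))))) := by
  have := isProbabilityMeasure_obsLaw hs
  set T := 3 * ‖s - G j₀‖ ^ 2 + 2 * pen j₀ + 2 * R + 2 * ε + Q with hTdef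
  let Y : J → (ι → X) → ℝ := fun j ω =>
    excess s (G j - G j₀) (fun x => g j x - g j₀ x) (b j) (w j) ω
  have hYm : ∀ j, Measurable (Y j) := fun j =>
    ((((measurable_empMean ((hg j).sub (hg j₀))).sub_const _).const_mul _).sub_const _).sub_const _
      |>.sub_const _
  -- The term at the random index is bounded by the sum over all indices, so measurability of `sel`
  -- is not needed.
  have key : ∀ ω, ‖s - G (sel ω)‖ₑ ^ (2 * p) ≤
      2 ^ p * (ENNReal.ofReal T ^ p + 2 ^ p * ∑' j, ENNReal.ofReal (Y j ω) ^ p) := by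
    intro ω
    have h1 := norm_sq_sub_le_of_crit_le (s := s) (hsel ω) (hw (sel ω)) (hQ (sel ω))
    rw [enorm_rpow_two_mul]
    refine (ENNReal.rpow_le_rpow (ENNReal.ofReal_le_ofReal h1) hp.le).trans ?_
    refine (ENNReal.rpow_le_rpow ENNReal.ofReal_add_le hp.le).trans ?_
    refine (ennreal_add_rpow_le hp.le _ _).trans ?_
    refine mul_le_mul_right (add_le_add le_rfl ?_) _
    rw [ENNReal.ofReal_mul (by norm_num), ENNReal.mul_rpow_of_nonneg _ _ hp.le,
      ENNReal.ofReal_ofNat]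
    exact mul_le_mul_right (ENNReal.le_tsum (f := fun j => ENNReal.ofReal (Y j ω) ^ p) (sel ω)) _
  refine (lintegral_mono key).trans ?_
  have hm2 : ∀ j, Measurable fun ω => ENNReal.ofReal (Y j ω) ^ p := fun j =>
    (hYm j).ennreal_ofReal.pow_const p
  have hm3 : Measurable fun ω => ∑' j, ENNReal.ofReal (Y j ω) ^ p := Measurable.tsum hm2
  rw [lintegral_const_mul _ (by fun_prop), lintegral_add_left measurable_const,
    lintegral_const_mul _ hm3,
    lintegral_tsum fun j => (hm2 j).aemeasurable, lintegral_const, measure_univ, mul_one]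
  refine mul_le_mul_right (add_le_add le_rfl (mul_le_mul_right (ENNReal.tsum_le_tsum fun j => ?_) _)) _
  refine lintegral_excess_rpow_le hs ((hg j).sub (hg j₀)) ?_ (hb j) (hbd j) (w j) hp
  filter_upwards [Lp.coeFn_sub (G j) (G j₀), hG j, hG j₀] with x h1 h2 h3
  rw [h1, Pi.sub_apply, h2, h3]; rfl

end Selection

/-! ### Gaussian sums over nets. -/

section Net

/-- A Gaussian sum over a net of controlled local cardinality. -/
lemma tsum_exp_neg_dist_sq_le {E : Type*} [MetricSpace E] {N : Set E} {η D κ : ℝ} (hη : 0 < η)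
    (hD : 1 / 2 ≤ D)
    (hN : ∀ x : ℝ, 2 ≤ x → ∀ t : E, (N ∩ Metric.ball t (x * η)).Finite ∧
        ((N ∩ Metric.ball t (x * η)).ncard : ℝ) ≤ Real.exp (D * x ^ 2))
    (hκ : κ * η ^ 2 = 3 * D) (t₀ : E) :
    ∑' t : N, ENNReal.ofReal (Real.exp (-(κ * dist (t : E) t₀ ^ 2))) ≤
      ENNReal.ofReal (3 * Real.exp (8 * D)) := by
  have hκ0 : 0 ≤ κ := by
    have : 0 < κ * η ^ 2 := by rw [hκ]; linarith
    exact (pos_of_mul_pos_left this (by positivity)).le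
  let B : ℕ → Set N := fun k => {t | dist (t : E) t₀ < (k + 2) * η}
  let a : ℕ → ℝ≥0∞ := fun k => ENNReal.ofReal (Real.exp (-(3 * D * k ^ 2)))
  have h1 : ∀ t : N, ENNReal.ofReal (Real.exp (-(κ * dist (t : E) t₀ ^ 2))) ≤
      ∑' k, (B k).indicator (fun _ => a k) t := by
    intro t
    -- Slicing into annuli of width `η`; the radius `k + 2` rather than `k + 1` keeps `x ≥ 2` in the
    -- counting bound.
    set k := ⌊dist (t : E) t₀ / η⌋₊ with hk
    have hk1 : (k : ℝ) * η ≤ dist (t : E) t₀ := by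
      rw [← le_div_iff₀ hη]; exact Nat.floor_le (by positivity)
    have hk2 : dist (t : E) t₀ < (k + 2) * η := by
      rw [← div_lt_iff₀ hη]; linarith [Nat.lt_floor_add_one (dist (t : E) t₀ / η)]
    refine le_trans ?_ (ENNReal.le_tsum k)
    rw [Set.indicator_of_mem (show t ∈ B k from hk2)]
    refine ENNReal.ofReal_le_ofReal (Real.exp_le_exp.2 (neg_le_neg ?_))
    rw [← hκ]
    have := pow_le_pow_left₀ (by positivity) hk1 2
    nlinarith
  have h2 : ∀ k, ∑' t, (B k).indicator (fun _ => a k) t ≤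
      ENNReal.ofReal (Real.exp (8 * D) * Real.exp (-(1 / 2)) ^ k) := by
    intro k
    obtain ⟨hf, hc⟩ := hN (k + 2) (by linarith [Nat.cast_nonneg (α := ℝ) k]) t₀
    have hB : (Subtype.val '' B k) = N ∩ Metric.ball t₀ ((k + 2) * η) := by
      ext t
      simp [B, Metric.mem_ball, and_comm]
    have henc : (B k).encard = ((N ∩ Metric.ball t₀ ((k + 2) * η)).ncard : ℕ∞) := by
      rw [← hB, ← Subtype.val_injective.encard_image (B k), Set.Finite.cast_ncard_eq (by rwa [hB])]
    rw [← tsum_subtype, ENNReal.tsum_const, ENat.card_coe_set_eq, henc, ENat.toENNReal_coe,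
      ← ENNReal.ofReal_natCast, ← ENNReal.ofReal_mul (by positivity)]
    refine ENNReal.ofReal_le_ofReal ((mul_le_mul_of_nonneg_right hc (Real.exp_pos _).le).trans ?_)
    rw [← Real.exp_add, ← Real.exp_nat_mul, ← Real.exp_add]
    refine Real.exp_le_exp.2 ?_
    -- `(k + 2)² - 3k² = 8 - (k - 2)² - k²`, and `D ≥ 1/2` turns `D k²` into at least `k / 2`.
    have hkk : (k : ℝ) ≤ k ^ 2 := by
      exact_mod_cast Nat.le_self_pow two_ne_zero k
    nlinarith [sq_nonneg ((k : ℝ) - 2), mul_nonneg (by linarith : (0:ℝ) ≤ D) (sq_nonneg ((k : ℝ) - 2)),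
      mul_nonneg (by linarith : (0:ℝ) ≤ D - 1 / 2) (sq_nonneg (k : ℝ))]
  calc _ ≤ ∑' t, ∑' k, (B k).indicator (fun _ => a k) t := ENNReal.tsum_le_tsum h1
    _ = ∑' k, ∑' t, (B k).indicator (fun _ => a k) t := ENNReal.tsum_comm
    _ ≤ ∑' k, ENNReal.ofReal (Real.exp (8 * D) * Real.exp (-(1 / 2)) ^ k) :=
      ENNReal.tsum_le_tsum h2
    _ ≤ _ := by
      have hr : Real.exp (-(1 / 2)) ≤ 2 / 3 := by
        rw [Real.exp_neg, inv_le_comm₀ (Real.exp_pos _) (by norm_num)]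
        linarith [Real.add_one_le_exp (1 / 2 : ℝ)]
      have hs := (hasSum_geometric_of_lt_one (Real.exp_pos (-(1 / 2))).le (by linarith)).mul_left
        (Real.exp (8 * D))
      rw [← ENNReal.ofReal_tsum_of_nonneg (fun k => by positivity) hs.summable, hs.tsum_eq]
      refine ENNReal.ofReal_le_ofReal ?_
      rw [mul_comm 3]
      refine mul_le_mul_of_nonneg_left ?_ (Real.exp_pos _).le
      rw [inv_le_comm₀ (by linarith) (by norm_num)]
      linarith

lemma countable_of_local_finite {E : Type*} [MetricSpace E] {N : Set E} {η : ℝ} (hη : 0 < η)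
    (hN : ∀ x : ℝ, 2 ≤ x → ∀ t : E, (N ∩ Metric.ball t (x * η)).Finite) : N.Countable := by
  rcases N.eq_empty_or_nonempty with rfl | ⟨t₀, -⟩
  · exact Set.countable_empty
  have : N ⊆ ⋃ k : ℕ, N ∩ Metric.ball t₀ ((k + 2) * η) := by
    intro t ht
    obtain ⟨k, hk⟩ := exists_nat_gt (dist t t₀ / η)
    refine Set.mem_iUnion.2 ⟨k, ht, ?_⟩
    rw [Metric.mem_ball, ← div_lt_iff₀ hη]
    linarith
  exact (Set.countable_iUnion fun k : ℕ =>
    (hN _ (by linarith [Nat.cast_nonneg (α := ℝ) k]) t₀).countable).mono this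

end Net

/-! ### Truncation of candidates to `[0, z]`. -/

section Truncation

variable {X : Type u} [MeasurableSpace X] {μ : Measure X}

/-- The truncation of `t` to the interval `[0, z]`. -/
noncomputable def truncFun (z : ℝ) (t : Lp ℝ 2 μ) (x : X) : ℝ := max 0 (min z (t x))

lemma measurable_truncFun (z : ℝ) (t : Lp ℝ 2 μ) : Measurable (truncFun z t) :=
  measurable_const.max (measurable_const.min (Lp.stronglyMeasurable t).measurable)

lemma truncFun_nonneg (z : ℝ) (t : Lp ℝ 2 μ) (x : X) : 0 ≤ truncFun z t x := le_max_left _ _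

lemma truncFun_le {z : ℝ} (hz : 0 ≤ z) (t : Lp ℝ 2 μ) (x : X) : truncFun z t x ≤ z :=
  max_le hz (min_le_left _ _)

lemma memLp_truncFun [IsFiniteMeasure μ] {z : ℝ} (hz : 0 ≤ z) (t : Lp ℝ 2 μ) :
    MemLp (truncFun z t) 2 μ :=
  MemLp.of_bound (measurable_truncFun z t).aestronglyMeasurable z
    (Filter.Eventually.of_forall fun x => by
      rw [Real.norm_of_nonneg (truncFun_nonneg z t x)]; exact truncFun_le hz t x)

/-- Where `t < 0` or `t > z`, truncation moves `t` towards `s`, except for the part of `s` above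
`z`. -/
lemma abs_sub_trunc_le {z t s : ℝ} (hz : 0 ≤ z) (hs : 0 ≤ s) :
    |t - max 0 (min z t)| ≤ |t - s| + max (s - z) 0 := by
  rcases max_cases 0 (min z t) with h | h <;> rcases min_cases z t with h' | h' <;>
  rcases max_cases (s - z) 0 with h'' | h'' <;> rcases abs_cases (t - s) with h3 | h3 <;>
  rcases abs_cases (t - max 0 (min z t)) with h4 | h4 <;> linarith

lemma norm_tail [IsFiniteMeasure μ] (s : Lp ℝ 2 μ) (z : ℝ) :
    ‖(memLp_tail s z).toLp‖ ^ 2 = tailQ μ s z := by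
  rw [norm_sq_eq_integral, tailQ_eq]
  exact integral_congr_ae ((memLp_tail s z).coeFn_toLp.fun_comp (fun y : ℝ => y ^ 2))

lemma norm_sub_trunc_le [IsFiniteMeasure μ] {s : Lp ℝ 2 μ} (hs : s ∈ densitiesL2 μ) {z : ℝ}
    (hz : 0 ≤ z) (t : Lp ℝ 2 μ) :
    ‖t - (memLp_truncFun hz t).toLp‖ ≤ ‖s - t‖ + Real.sqrt (tailQ μ s z) := by
  have h1 : ‖t - (memLp_truncFun hz t).toLp‖ ≤ ‖|t - s| + (memLp_tail s z).toLp‖ := by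
    refine Lp.norm_le_norm_of_ae_le ?_
    filter_upwards [Lp.coeFn_sub t (memLp_truncFun hz t).toLp, (memLp_truncFun hz t).coeFn_toLp,
      Lp.coeFn_add |t - s| (memLp_tail s z).toLp, (memLp_tail s z).coeFn_toLp,
      Lp.coeFn_abs (t - s), Lp.coeFn_sub t s, hs.1] with x h1 h2 h3 h4 h5 h6 h7
    rw [h1, h3, Pi.sub_apply, Pi.add_apply, h2, h4, h5, h6, Pi.sub_apply, Real.norm_eq_abs,
      Real.norm_eq_abs]
    exact (abs_sub_trunc_le hz h7).trans (le_abs_self _)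
  refine h1.trans ((norm_add_le _ _).trans ?_)
  rw [norm_abs_eq_norm, norm_sub_rev, ← norm_tail, Real.sqrt_sq (norm_nonneg _)]

end Truncation

/-! ### Estimation at a fixed truncation level. -/

section Level

variable {X : Type u} [MeasurableSpace X] {μ : Measure X} {ι : Type*} [Fintype ι]

/-- The constant in the risk bound at a fixed truncation level. -/
noncomputable def levelConst (p : ℝ) : ℝ≥0∞ :=
  2 ^ p * (2800000 ^ p + 3 * ENNReal.ofReal (p ^ p) * 128 ^ p)

lemma add_add_rpow_le {p : ℝ} (hp : 0 ≤ p) (a b c : ℝ≥0∞) :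
    (a + b + c) ^ p ≤ 4 ^ p * (a ^ p + b ^ p + c ^ p) := by
  have h : a + b + c ≤ 4 * max (max a b) c := by
    have h1 : a ≤ max (max a b) c := (le_max_left _ _).trans (le_max_left _ _)
    have h2 : b ≤ max (max a b) c := (le_max_right _ _).trans (le_max_left _ _)
    have h3 : c ≤ max (max a b) c := le_max_right _ _
    calc a + b + c ≤ max (max a b) c + max (max a b) c + max (max a b) c := by gcongr
      _ = 3 * max (max a b) c := by ring
      _ ≤ _ := by gcongr; norm_num
  refine (ENNReal.rpow_le_rpow h hp).trans ?_
  rw [ENNReal.mul_rpow_of_nonneg _ _ hp]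
  refine mul_le_mul_right ?_ _
  rcases max_choice (max a b) c with h | h <;> rw [h]
  · rcases max_choice a b with h | h <;> rw [h]
    · exact le_self_add.trans le_self_add
    · exact le_add_self.trans le_self_add
  · exact le_add_self

/-- Makes the risk bound vacuous for an empty model; the constant must be nonzero because `0 * ⊤ =
0`. -/
lemma mul_infEDist_empty_eq_top {E : Type*} [PseudoEMetricSpace E] {Sig p : ℝ} (hSig : 1 ≤ Sig)
    (hp : 0 < p) (s : E) (a b : ℝ≥0∞) :
    levelConst p * ENNReal.ofReal Sig * (Metric.infEDist s ∅ ^ (2 * p) + a + b) = ⊤ := by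
  have hc : levelConst p * ENNReal.ofReal Sig ≠ 0 := by
    refine mul_ne_zero ?_ (by simpa using by linarith)
    exact mul_ne_zero (by simp [ENNReal.rpow_eq_zero_iff]) (by simp [ENNReal.rpow_eq_zero_iff])
  rw [Metric.infEDist_empty, ENNReal.top_rpow_of_pos (by linarith), top_add, top_add,
    ENNReal.mul_top hc]

/-- Truncation may merge net points, so the net structure controls `‖t - F₀‖` and not `‖F t - F₀‖`;
the term `‖t - F t‖²` restores the former. Since `288 / 32 = 9`, the weight yields `exp (-(8 D +
Δ))`: `8 D` cancels the Gaussian sum and `Δ` sums to `Sig`. -/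
lemma tsum_sigma_weight_le {M : Type v} {N : M → Set (Lp ℝ 2 μ)} {D Δ : M → ℝ} {Sig : ℝ}
    (hD : ∀ m, 1 / 2 ≤ D m) (hΔ : HasSum (fun m => Real.exp (-Δ m)) Sig)
    {z n : ℝ} (hz : 0 < z) (hn : 0 < n)
    {η : M → ℝ} (hη : ∀ m, 0 < η m) (hη2 : ∀ m, η m ^ 2 = 3072 * z * D m / n)
    (hN : ∀ m, ∀ x : ℝ, 2 ≤ x → ∀ t, (N m ∩ Metric.ball t (x * η m)).Finite ∧
        ((N m ∩ Metric.ball t (x * η m)).ncard : ℝ) ≤ Real.exp (D m * x ^ 2))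
    (F₀ : Lp ℝ 2 μ) (F : Lp ℝ 2 μ → Lp ℝ 2 μ) :
    ∑' j : Σ m, N m, ENNReal.ofReal (Real.exp (-(n * (1 / 16 * (‖F j.2 - F₀‖ ^ 2 +
        ‖(j.2 : Lp ℝ 2 μ) - F j.2‖ ^ 2) + 288 * z * max (D j.1) (Δ j.1) / n) / (32 * z)))) ≤
      3 * ENNReal.ofReal Sig := by
  rw [ENNReal.tsum_sigma']
  have h1 : ∀ m, ∑' t : N m, ENNReal.ofReal (Real.exp (-(n * (1 / 16 * (‖F t - F₀‖ ^ 2 +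
        ‖(t : Lp ℝ 2 μ) - F t‖ ^ 2) + 288 * z * max (D m) (Δ m) / n) / (32 * z)))) ≤
      3 * ENNReal.ofReal (Real.exp (-Δ m)) := by
    intro m
    have h2 := tsum_exp_neg_dist_sq_le (hη m) (hD m) (hN m) (κ := n / (1024 * z))
      (by rw [hη2]; field_simp; ring) F₀
    have h3 : ∀ t : N m, ENNReal.ofReal (Real.exp (-(n * (1 / 16 * (‖F t - F₀‖ ^ 2 +
        ‖(t : Lp ℝ 2 μ) - F t‖ ^ 2) + 288 * z * max (D m) (Δ m) / n) / (32 * z)))) ≤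
        ENNReal.ofReal (Real.exp (-(8 * D m + Δ m))) *
          ENNReal.ofReal (Real.exp (-(n / (1024 * z) * dist (t : Lp ℝ 2 μ) F₀ ^ 2))) := by
      intro t
      rw [← ENNReal.ofReal_mul (Real.exp_pos _).le, ← Real.exp_add]
      refine ENNReal.ofReal_le_ofReal (Real.exp_le_exp.2 ?_)
      have h4 : dist (t : Lp ℝ 2 μ) F₀ ^ 2 ≤
          2 * (‖F t - F₀‖ ^ 2 + ‖(t : Lp ℝ 2 μ) - F t‖ ^ 2) := by
        have := norm_sub_le_norm_sub_add_norm_sub (t : Lp ℝ 2 μ) (F t) F₀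
        rw [dist_eq_norm]
        nlinarith [norm_nonneg ((t : Lp ℝ 2 μ) - F₀),
          sq_nonneg (‖F t - F₀‖ - ‖(t : Lp ℝ 2 μ) - F t‖)]
      have h5 : n * (1 / 16 * (‖F t - F₀‖ ^ 2 + ‖(t : Lp ℝ 2 μ) - F t‖ ^ 2) +
          288 * z * max (D m) (Δ m) / n) / (32 * z) = n / (1024 * z) *
          (2 * (‖F t - F₀‖ ^ 2 + ‖(t : Lp ℝ 2 μ) - F t‖ ^ 2)) + 9 * max (D m) (Δ m) := by
        field_simp; ring
      have h6 := mul_le_mul_of_nonneg_left h4 (by positivity : 0 ≤ n / (1024 * z))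
      rw [h5]
      linarith [le_max_left (D m) (Δ m), le_max_right (D m) (Δ m)]
    refine (ENNReal.tsum_le_tsum h3).trans ?_
    rw [ENNReal.tsum_mul_left]
    refine (mul_le_mul_right h2 _).trans ?_
    rw [← ENNReal.ofReal_mul (Real.exp_pos _).le, ← ENNReal.ofReal_ofNat 3,
      ← ENNReal.ofReal_mul (by norm_num)]
    refine ENNReal.ofReal_le_ofReal (le_of_eq ?_)
    rw [mul_left_comm, ← Real.exp_add]
    ring_nf
  refine (ENNReal.tsum_le_tsum h1).trans ?_
  rw [ENNReal.tsum_mul_left, ← ENNReal.ofReal_tsum_of_nonneg (fun _ => (Real.exp_pos _).le)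
    hΔ.summable, hΔ.tsum_eq]

lemma exists_net_approx {E : Type*} [MetricSpace E] {S N : Set E} {η : ℝ} (hη : 0 < η)
    (hN : IsNetFor η N S) (hS : S.Nonempty) (s : E) :
    ∃ t ∈ N, dist s t ≤ Metric.infDist s S + 2 * η := by
  obtain ⟨t, ht, h1⟩ := (Metric.infDist_lt_iff hS).1
    (show Metric.infDist s S < Metric.infDist s S + η by linarith)
  obtain ⟨t', ht', h2⟩ := hN t ht
  exact ⟨t', ht', by linarith [dist_triangle s t t']⟩

lemma exists_level_estimator [IsFiniteMeasure μ] [Nonempty ι] {M : Type v} [Countable M]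
    {S : M → Set (Lp ℝ 2 μ)} {D Δ : M → ℝ} {Sig : ℝ}
    (hD : ∀ m, 1 / 2 ≤ D m) (hS : ∀ m, HasMetricDimLE (S m) (D m))
    (hΔ : HasSum (fun m => Real.exp (-Δ m)) Sig) (hSig : 1 ≤ Sig) {z : ℝ} (hz : 0 < z) :
    ∃ (G : ℕ → Lp ℝ 2 μ) (g : ℕ → X → ℝ) (k : (ι → X) → ℕ),
      (∀ i, Measurable (g i)) ∧ (∀ i, G i =ᵐ[μ] g i) ∧ (∀ i x, 0 ≤ g i x ∧ g i x ≤ z) ∧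
      Measurable k ∧ ∀ s ∈ densitiesL2 μ, ∀ p : ℝ, 0 < p → ∀ m,
        ∫⁻ ω : ι → X, ‖s - G (k ω)‖ₑ ^ (2 * p) ∂(Measure.pi fun _ => obsLaw μ s) ≤
          levelConst p * ENNReal.ofReal Sig * (Metric.infEDist s (S m) ^ (2 * p) +
            ENNReal.ofReal (z * max (D m) (Δ m) / Fintype.card ι) ^ p +
            ENNReal.ofReal (tailQ μ s z) ^ p) := by
  classical
  set n : ℝ := (Fintype.card ι : ℝ) with hn
  have hn0 : 0 < n := by rw [hn]; exact_mod_cast Fintype.card_pos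
  have hD0 : ∀ m, 0 < D m := fun m => by linarith [hD m]
  -- Chosen so that `κ η² = 3 D` for the Gaussian rate `κ = n / (1024 z)`; `η²` is also of the order
  -- of the target risk.
  set η : M → ℝ := fun m => Real.sqrt (3072 * z * D m / n) with hηdef
  have hpos : ∀ m, 0 < 3072 * z * D m / n := fun m => by have := hD0 m; positivity
  have hη : ∀ m, 0 < η m := fun m => Real.sqrt_pos.2 (hpos m)
  have hη2 : ∀ m, η m ^ 2 = 3072 * z * D m / n := fun m => Real.sq_sqrt (hpos m).le
  choose N hN1 hN2 using fun m => (hS m).2 (η m) (hη m)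
  have : ∀ m, Countable (N m) := fun m =>
    (countable_of_local_finite (hη m) fun x hx t => (hN2 m x hx t).1).to_subtype
  by_cases hJ : Nonempty (Σ m, N m)
  swap
  · refine ⟨fun _ => 0, fun _ _ => 0, fun _ => 0, fun _ => measurable_const,
      fun _ => Lp.coeFn_zero _ _ _, fun _ _ => ⟨le_rfl, hz.le⟩, measurable_const,
      fun s _ p hp m => ?_⟩
    have hSm : S m = ∅ := by
      by_contra h
      obtain ⟨t, ht⟩ := Set.nonempty_iff_ne_empty.2 h
      obtain ⟨t', ht', -⟩ := hN1 m t ht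
      exact hJ ⟨⟨m, t', ht'⟩⟩
    rw [hSm, mul_infEDist_empty_eq_top hSig hp]
    exact le_top
  obtain ⟨e, he⟩ := exists_surjective_nat (Σ m, N m)
  let G : (Σ m, N m) → Lp ℝ 2 μ := fun j => (memLp_truncFun hz.le (j.2 : Lp ℝ 2 μ)).toLp
  let g : (Σ m, N m) → X → ℝ := fun j => truncFun z (j.2 : Lp ℝ 2 μ)
  -- The truncation error is part of the penalty. At the oracle net point it is cheap, by
  -- `norm_sub_trunc_le`.
  let pen : (Σ m, N m) → ℝ := fun j =>
    ‖(j.2 : Lp ℝ 2 μ) - G j‖ ^ 2 + 288 * z * max (D j.1) (Δ j.1) / n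
  have hmax : ∀ m, 1 / 2 ≤ max (D m) (Δ m) := fun m => (hD m).trans (le_max_left _ _)
  have hpen : ∀ j, 0 ≤ pen j := fun j => by
    have : 0 ≤ max (D j.1) (Δ j.1) := by linarith [hmax j.1]
    positivity
  obtain ⟨k, hk, hkε⟩ := exists_measurable_approx_argmin
    (c := fun i (ω : ι → X) => crit (G (e i)) (g (e i)) (pen (e i)) ω)
    (fun i => measurable_crit _ (measurable_truncFun z _) _) (fun ω => ⟨-(2 * z), by
        rintro _ ⟨i, rfl⟩
        have h1 := empMean_le hz.le (truncFun_le hz.le ((e i).2 : Lp ℝ 2 μ)) ω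
        have h2 := hpen (e i)
        have h3 := sq_nonneg ‖G (e i)‖
        simp only [crit]
        linarith⟩) (div_pos hz hn0)
  refine ⟨fun i => G (e i), fun i => g (e i), k, fun i => measurable_truncFun z _,
    fun i => (memLp_truncFun hz.le _).coeFn_toLp,
    fun i x => ⟨truncFun_nonneg z _ x, truncFun_le hz.le _ x⟩, hk, fun s hs p hp m => ?_⟩
  rcases (S m).eq_empty_or_nonempty with hSm | hSm
  · rw [hSm, mul_infEDist_empty_eq_top hSig hp]
    exact le_top
  obtain ⟨t, ht, hst⟩ := exists_net_approx (hη m) (hN1 m) hSm s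
  let j₀ : Σ m, N m := ⟨m, t, ht⟩
  set v : ℝ := z * max (D m) (Δ m) / n with hv
  have hv0 : z / n ≤ 2 * v := by
    rw [hv, mul_div_right_comm]
    have := mul_le_mul_of_nonneg_left (hmax m) (div_pos hz hn0).le
    linarith
  have hvpos : 0 < v := by linarith [div_pos hz hn0]
  have hsel := lintegral_selection_le hs (fun j => measurable_truncFun z (j.2 : Lp ℝ 2 μ))
    (G := G) (fun j => (memLp_truncFun hz.le _).coeFn_toLp) (pen := pen) (b := fun _ => z)
    (w := fun j => 1 / 16 * (‖G j - G j₀‖ ^ 2 + ‖(j.2 : Lp ℝ 2 μ) - G j‖ ^ 2) +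
      288 * z * max (D j.1) (Δ j.1) / n) (R := 0) (ε := z / n) (Q := tailQ μ s z) j₀
    (fun _ => hz) (fun j x => by
      have h1 := truncFun_nonneg z (j.2 : Lp ℝ 2 μ) x
      have h2 := truncFun_le hz.le (j.2 : Lp ℝ 2 μ) x
      have h3 := truncFun_nonneg z (j₀.2 : Lp ℝ 2 μ) x
      have h4 := truncFun_le hz.le (j₀.2 : Lp ℝ 2 μ) x
      rw [abs_le]; constructor <;> linarith) (fun _ => le_rfl)
    (fun j => by
      have := sq_nonneg ‖(j.2 : Lp ℝ 2 μ) - G j‖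
      simp only [pen]
      linarith) (sel := fun ω => e (k ω)) (fun ω => by
        obtain ⟨i, hi⟩ := he j₀
        have := hkε ω i
        rw [hi] at this
        exact this) hp
  refine hsel.trans ?_
  rw [← hn]
  set I := Metric.infDist s (S m) with hI
  set Q := tailQ μ s z with hQ
  have hQ0 : 0 ≤ Q := tailQ_nonneg s z
  -- The left side is at most `28 δ² + 11 Q + 580 v`, with `δ² ≤ 2 I² + 8 · 3072 v`.
  have hT : 3 * ‖s - G j₀‖ ^ 2 + 2 * pen j₀ + 2 * 0 + 2 * (z / n) + Q ≤
      700000 * (I ^ 2 + v + Q) := by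
    have h1 : ‖t - G j₀‖ ≤ ‖s - t‖ + Real.sqrt Q := norm_sub_trunc_le hs hz.le t
    have h2 : ‖s - G j₀‖ ≤ ‖s - t‖ + ‖t - G j₀‖ := norm_sub_le_norm_sub_add_norm_sub _ _ _
    have h3 : Real.sqrt Q ^ 2 = Q := Real.sq_sqrt (tailQ_nonneg s z)
    set δ := ‖s - t‖
    have hδ : δ ≤ I + 2 * η m := (dist_eq_norm s t).symm.trans_le hst
    have hδ0 : 0 ≤ δ := norm_nonneg _
    have hηv : η m ^ 2 ≤ 3072 * v := by
      rw [hη2, hv, mul_assoc, mul_div_assoc]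
      gcongr
      exact le_max_left _ _
    have h4 : ‖t - G j₀‖ ^ 2 ≤ 2 * δ ^ 2 + 2 * Q := by
      nlinarith [norm_nonneg (t - G j₀), sq_nonneg (δ - Real.sqrt Q)]
    have h5 : ‖s - G j₀‖ ^ 2 ≤ 8 * δ ^ 2 + 2 * Q := by
      have : ‖s - G j₀‖ ≤ 2 * δ + Real.sqrt Q := by linarith
      nlinarith [norm_nonneg (s - G j₀), sq_nonneg (2 * δ - Real.sqrt Q)]
    have h6 : δ ^ 2 ≤ 2 * I ^ 2 + 8 * η m ^ 2 := by
      nlinarith [sq_nonneg (I - 2 * η m)]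
    have h7 : pen j₀ = ‖t - G j₀‖ ^ 2 + 288 * v := by
      simp only [pen, j₀, hv]; ring
    rw [h7]
    linarith [sq_nonneg I]
  have hE : Metric.infEDist s (S m) = ENNReal.ofReal I := by
    rw [hI, Metric.infDist, ENNReal.ofReal_toReal (Metric.infEDist_ne_top hSm)]
  have hI0 : 0 ≤ I := Metric.infDist_nonneg
  have hsum := tsum_sigma_weight_le hD hΔ hz hn0 hη hη2 hN2 (G j₀)
    (fun t => (memLp_truncFun hz.le t).toLp)
  have hA : ENNReal.ofReal (3 * ‖s - G j₀‖ ^ 2 + 2 * pen j₀ + 2 * 0 + 2 * (z / n) + Q) ^ p ≤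
      2800000 ^ p * (Metric.infEDist s (S m) ^ (2 * p) + ENNReal.ofReal v ^ p +
        ENNReal.ofReal Q ^ p) := by
    refine (ENNReal.rpow_le_rpow (ENNReal.ofReal_le_ofReal hT) hp.le).trans ?_
    rw [ENNReal.ofReal_mul (by norm_num), ENNReal.ofReal_add (by positivity) hQ0,
      ENNReal.ofReal_add (by positivity) hvpos.le, ENNReal.mul_rpow_of_nonneg _ _ hp.le,
      hE, ENNReal.rpow_mul, ENNReal.rpow_ofNat, ← ENNReal.ofReal_pow hI0]
    refine (mul_le_mul_right (add_add_rpow_le hp.le _ _ _) _).trans (le_of_eq ?_)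
    rw [← mul_assoc, ← ENNReal.mul_rpow_of_nonneg _ _ hp.le, ENNReal.ofReal_ofNat]
    norm_num
  have hB : ∑' j : Σ m, N m, ENNReal.ofReal (p ^ p * (32 * z / n) ^ p *
      Real.exp (-(n * (1 / 16 * (‖G j - G j₀‖ ^ 2 + ‖(j.2 : Lp ℝ 2 μ) - G j‖ ^ 2) +
      288 * z * max (D j.1) (Δ j.1) / n) / (32 * z)))) ≤
      ENNReal.ofReal (p ^ p) * (64 ^ p * ENNReal.ofReal v ^ p) * (3 * ENNReal.ofReal Sig) := by
    have h1 : ENNReal.ofReal (p ^ p * (32 * z / n) ^ p) ≤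
        ENNReal.ofReal (p ^ p) * (64 ^ p * ENNReal.ofReal v ^ p) := by
      rw [ENNReal.ofReal_mul (by positivity), ← ENNReal.ofReal_rpow_of_pos (show 0 < 32 * z / n by positivity),
        ← ENNReal.mul_rpow_of_nonneg _ _ hp.le, ← ENNReal.ofReal_ofNat 64,
        ← ENNReal.ofReal_mul (by norm_num)]
      gcongr
      rw [mul_div_assoc]
      linarith
    calc _ = ∑' j : Σ m, N m, ENNReal.ofReal (p ^ p * (32 * z / n) ^ p) * ENNReal.ofReal (
      Real.exp (-(n * (1 / 16 * (‖G j - G j₀‖ ^ 2 + ‖(j.2 : Lp ℝ 2 μ) - G j‖ ^ 2) +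
      288 * z * max (D j.1) (Δ j.1) / n) / (32 * z)))) :=
          tsum_congr fun j => ENNReal.ofReal_mul (by positivity)
      _ ≤ _ := by
          rw [ENNReal.tsum_mul_left]
          exact mul_le_mul' h1 hsum
  have hSig' : (1 : ℝ≥0∞) ≤ ENNReal.ofReal Sig := by simpa using hSig
  set U := Metric.infEDist s (S m) ^ (2 * p) + ENNReal.ofReal v ^ p + ENNReal.ofReal Q ^ p with hU
  have hvU : ENNReal.ofReal v ^ p ≤ U := le_add_self.trans le_self_add
  calc _ ≤ 2 ^ p * (2800000 ^ p * U + 2 ^ p *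
        (ENNReal.ofReal (p ^ p) * (64 ^ p * ENNReal.ofReal v ^ p) * (3 * ENNReal.ofReal Sig))) := by
        gcongr
    _ ≤ 2 ^ p * (2800000 ^ p * (U * ENNReal.ofReal Sig) + 2 ^ p *
        (ENNReal.ofReal (p ^ p) * (64 ^ p * U) * (3 * ENNReal.ofReal Sig))) := by
        gcongr
        exact le_mul_of_one_le_right zero_le hSig'
    _ = levelConst p * ENNReal.ofReal Sig * U := by
        rw [levelConst, show (128 : ℝ≥0∞) = 2 * 64 by norm_num,
          ENNReal.mul_rpow_of_nonneg _ _ hp.le]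
        ring

end Level

/-! ### Choice of the truncation level on an independent sample. -/

section LevelSelection

variable {X : Type u} [MeasurableSpace X] {μ : Measure X} {ι₁ ι₂ : Type*} [Fintype ι₁] [Fintype ι₂]

/-- The constant in the risk bound of the selection of a truncation level. -/
noncomputable def selConst (A p : ℝ) : ℝ≥0∞ :=
  2 ^ p * (ENNReal.ofReal (3 + 128 * A) ^ p * 4 ^ p + 2 ^ p * (ENNReal.ofReal (p ^ p) * 32 ^ p *
    ∑' i : ℕ, ENNReal.ofReal (2 ^ p * Real.exp (-A)) ^ (i + 1)))

/-- The penalty attached to the truncation level `2 ^ (i + 1)`. -/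
noncomputable def levelPen (A n : ℝ) (i : ℕ) : ℝ := 32 * A * ((i + 1) * 2 ^ (i + 1) / n)

lemma levelPen_nonneg {A n : ℝ} (hA : 0 < A) (hn : 0 < n) (i : ℕ) : 0 ≤ levelPen A n i := by
  unfold levelPen; positivity

/-- Once `i + 1 ≥ n / (16 A)` the penalty dominates `2 * 2 ^ (i + 1)`. Hence the criterion is
bounded below over all levels, as an approximate minimiser requires. -/
lemma bddBelow_levelPen_sub {A n : ℝ} (hA : 0 < A) (hn : 0 < n) :
    ∃ L : ℝ, ∀ i : ℕ, L ≤ levelPen A n i - 2 * 2 ^ (i + 1) := by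
  obtain ⟨N, hN⟩ := exists_nat_ge (n / (16 * A))
  refine ⟨-(2 * 2 ^ (N + 1)), fun i => ?_⟩
  rcases le_or_gt N i with h | h
  · have h1 : n / (16 * A) ≤ i + 1 := by
      have : (N : ℝ) ≤ i := by exact_mod_cast h
      linarith
    rw [div_le_iff₀ (by positivity)] at h1
    have h2 : levelPen A n i = 2 * 2 ^ (i + 1) * (((i : ℝ) + 1) * (16 * A) / n) := by
      unfold levelPen; ring
    have h3 : 1 ≤ ((i : ℝ) + 1) * (16 * A) / n := by rwa [le_div_iff₀ hn, one_mul]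
    have h4 : (0 : ℝ) < 2 * 2 ^ (i + 1) := by positivity
    have h5 : (0 : ℝ) < 2 * 2 ^ (N + 1) := by positivity
    nlinarith
  · have h1 : (2 : ℝ) ^ (i + 1) ≤ 2 ^ (N + 1) := pow_le_pow_right₀ (by norm_num) (by omega)
    linarith [levelPen_nonneg hA hn i]

/-- Two levels are compared at the larger scale `b`. Adding both penalties gives `(i + 1) b`
whichever level is larger, hence the decay `exp (-A (i + 1))`; bounding the maximum by the product
isolates the oracle scale at the price of `2 ^ (p (i + 1))`. -/
lemma level_weight_le {A n p : ℝ} (hA : 0 < A) (hn : 0 < n) (hp : 0 < p) (i i₀ : ℕ) :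
    p ^ p * (32 * max (2 ^ (i + 1)) (2 ^ (i₀ + 1)) / n) ^ p *
      Real.exp (-(n * (levelPen A n i + levelPen A n i₀) /
        (32 * max (2 ^ (i + 1)) (2 ^ (i₀ + 1))))) ≤
      p ^ p * 32 ^ p * (2 ^ (i₀ + 1) / n) ^ p * (2 ^ p * Real.exp (-A)) ^ (i + 1) := by
  set b : ℝ := max (2 ^ (i + 1)) (2 ^ (i₀ + 1)) with hb
  have hb0 : 0 < b := lt_max_of_lt_left (by positivity)
  have h1 : b ≤ 2 ^ (i + 1) * 2 ^ (i₀ + 1) := by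
    have e1 : (1 : ℝ) ≤ 2 ^ (i + 1) := one_le_pow₀ (by norm_num)
    have e2 : (1 : ℝ) ≤ 2 ^ (i₀ + 1) := one_le_pow₀ (by norm_num)
    exact max_le (le_mul_of_one_le_right (by positivity) e2)
      (le_mul_of_one_le_left (by positivity) e1)
  have h2 : A * ((i + 1 : ℕ) : ℝ) ≤ n * (levelPen A n i + levelPen A n i₀) / (32 * b) := by
    have e : n * (levelPen A n i + levelPen A n i₀) =
        32 * A * ((i + 1) * 2 ^ (i + 1) + (i₀ + 1) * 2 ^ (i₀ + 1)) := by
      unfold levelPen; field_simp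
    rw [le_div_iff₀ (by positivity), e]
    have e3 : ((i : ℝ) + 1) * b ≤ (i + 1) * 2 ^ (i + 1) + (i₀ + 1) * 2 ^ (i₀ + 1) := by
      rcases le_or_gt i i₀ with h | h
      · have e4 : b = 2 ^ (i₀ + 1) :=
          max_eq_right (pow_le_pow_right₀ (by norm_num) (by omega))
        have e5 : (i : ℝ) ≤ i₀ := by exact_mod_cast h
        rw [e4]
        have : (0 : ℝ) ≤ (i + 1) * 2 ^ (i + 1) := by positivity
        have : ((i : ℝ) + 1) * 2 ^ (i₀ + 1) ≤ (i₀ + 1) * 2 ^ (i₀ + 1) := by gcongr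
        linarith
      · have e4 : b = 2 ^ (i + 1) := max_eq_left (pow_le_pow_right₀ (by norm_num) (by omega))
        rw [e4]
        have : (0 : ℝ) ≤ (i₀ + 1) * 2 ^ (i₀ + 1) := by positivity
        linarith
    push_cast
    nlinarith
  have h3 : (32 * b / n) ^ p ≤ 32 ^ p * (2 ^ (i₀ + 1) / n) ^ p * (2 ^ p) ^ (i + 1) := by
    have e : ((2 : ℝ) ^ p) ^ (i + 1) = (2 ^ (i + 1)) ^ p := by
      rw [← Real.rpow_natCast, ← Real.rpow_mul (by norm_num), mul_comm,
        Real.rpow_mul (by norm_num), Real.rpow_natCast]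
    rw [e, ← Real.mul_rpow (by norm_num) (by positivity),
      ← Real.mul_rpow (by positivity) (by positivity)]
    refine Real.rpow_le_rpow (by positivity) ?_ hp.le
    rw [mul_div_assoc, mul_assoc, div_mul_eq_mul_div, mul_comm (2 ^ (i₀ + 1))]
    gcongr
  have h4 : Real.exp (-(n * (levelPen A n i + levelPen A n i₀) / (32 * b))) ≤
      Real.exp (-A) ^ (i + 1) := by
    rw [← Real.exp_nat_mul]
    refine Real.exp_le_exp.2 ?_
    linarith
  calc _ ≤ p ^ p * (32 ^ p * (2 ^ (i₀ + 1) / n) ^ p * (2 ^ p) ^ (i + 1)) *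
        Real.exp (-A) ^ (i + 1) := by gcongr
    _ = _ := by rw [mul_pow]; ring

lemma measurable_crit_index {ι : Type*} [Fintype ι] {G : ℕ → Lp ℝ 2 μ} {g : ℕ → X → ℝ}
    (hg : ∀ j, Measurable (g j)) (pen : ℝ) :
    Measurable fun a : ℕ × (ι → X) => crit (G a.1) (g a.1) pen a.2 := by
  refine measurable_from_prod_countable_right fun j => ?_
  change Measurable (crit (G j) (g j) pen)
  exact measurable_crit (G j) (hg j) pen

lemma exists_level_selection [IsFiniteMeasure μ] [Nonempty ι₂]
    {G : ℕ → ℕ → Lp ℝ 2 μ} {g : ℕ → ℕ → X → ℝ} {k : ℕ → (ι₁ → X) → ℕ}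
    (hg : ∀ i j, Measurable (g i j)) (hG : ∀ i j, G i j =ᵐ[μ] g i j)
    (hbd : ∀ i j x, 0 ≤ g i j x ∧ g i j x ≤ 2 ^ (i + 1)) (hk : ∀ i, Measurable (k i))
    {A : ℝ} (hA : 0 < A) :
    ∃ est : (ι₁ → X) × (ι₂ → X) → Lp ℝ 2 μ, StronglyMeasurable est ∧
      ∀ s ∈ densitiesL2 μ, ∀ p : ℝ, 0 < p → ∀ i₀ : ℕ,
        ∫⁻ ω, ‖s - est ω‖ₑ ^ (2 * p)
          ∂((Measure.pi fun _ : ι₁ => obsLaw μ s).prod (Measure.pi fun _ : ι₂ => obsLaw μ s)) ≤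
        selConst A p * (∫⁻ ω, ‖s - G i₀ (k i₀ ω)‖ₑ ^ (2 * p) ∂(Measure.pi fun _ => obsLaw μ s) +
          ENNReal.ofReal ((i₀ + 1) * 2 ^ (i₀ + 1) / Fintype.card ι₂) ^ p +
          ENNReal.ofReal (tailQ μ s (2 ^ (i₀ + 1))) ^ p) := by
  classical
  set n : ℝ := (Fintype.card ι₂ : ℝ) with hn
  have hn0 : 0 < n := by rw [hn]; exact_mod_cast Fintype.card_pos
  obtain ⟨L, hL⟩ := bddBelow_levelPen_sub hA hn0
  have hcm : ∀ i, Measurable fun ω : (ι₁ → X) × (ι₂ → X) =>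
      crit (G i (k i ω.1)) (g i (k i ω.1)) (levelPen A n i) ω.2 := by
    intro i
    have h1 : Measurable fun a : ℕ × (ι₂ → X) => crit (G i a.1) (g i a.1) (levelPen A n i) a.2 :=
      measurable_crit_index (G := G i) (hg i) _
    have h2 := h1.comp (((hk i).comp measurable_fst).prodMk measurable_snd)
    exact h2
  obtain ⟨sel, hsel, hselε⟩ := exists_measurable_approx_argmin hcm (fun ω => ⟨L, by
    rintro _ ⟨i, rfl⟩
    have h1 := empMean_le (by positivity) (fun x => (hbd i (k i ω.1) x).2) ω.2
    have h2 := sq_nonneg ‖G i (k i ω.1)‖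
    simp only [crit]
    linarith [hL i]⟩) (one_div_pos.2 hn0)
  -- The estimator factors through `ℕ × ℕ`, so no separability of `L²(μ)` is needed.
  have hest : StronglyMeasurable fun ω : (ι₁ → X) × (ι₂ → X) => G (sel ω) (k (sel ω) ω.1) := by
    have h1 : Measurable fun a : ℕ × (ι₁ → X) => k a.1 a.2 :=
      measurable_from_prod_countable_right fun i => hk i
    have h2 : Measurable fun ω : (ι₁ → X) × (ι₂ → X) => (sel ω, k (sel ω) ω.1) :=
      hsel.prodMk (h1.comp (hsel.prodMk measurable_fst))
    exact (StronglyMeasurable.of_discrete (f := fun a : ℕ × ℕ => G a.1 a.2)).comp_measurable h2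
  refine ⟨_, hest, fun s hs p hp i₀ => ?_⟩
  have := isProbabilityMeasure_obsLaw hs
  set z₀ : ℝ := 2 ^ (i₀ + 1) with hz₀
  have hz₀1 : 1 ≤ z₀ := one_le_pow₀ (by norm_num)
  set u : ℝ := (i₀ + 1) * z₀ / n with hu
  have hu0 : 0 < u := by positivity
  have hzu : z₀ / n ≤ u := by
    rw [hu, mul_div_assoc]
    exact le_mul_of_one_le_left (by positivity) (by linarith [Nat.cast_nonneg (α := ℝ) i₀])
  have h1u : 1 / n ≤ u := (by gcongr : 1 / n ≤ z₀ / n).trans hzu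
  set Q := tailQ μ s z₀ with hQ
  have hQ0 : 0 ≤ Q := tailQ_nonneg s z₀
  set r := ∑' i : ℕ, ENNReal.ofReal (2 ^ p * Real.exp (-A)) ^ (i + 1) with hr
  -- Conditionally on the first sample, each level offers one fixed function.
  have cond : ∀ ω₁ : ι₁ → X, ∫⁻ ω₂ : ι₂ → X, ‖s - G (sel (ω₁, ω₂)) (k (sel (ω₁, ω₂)) ω₁)‖ₑ ^ (2 * p)
      ∂(Measure.pi fun _ => obsLaw μ s) ≤
      selConst A p * (‖s - G i₀ (k i₀ ω₁)‖ₑ ^ (2 * p) + ENNReal.ofReal u ^ p +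
        ENNReal.ofReal Q ^ p) := by
    intro ω₁
    refine (lintegral_selection_le hs (fun i => hg i (k i ω₁)) (G := fun i => G i (k i ω₁))
      (fun i => hG i (k i ω₁)) (pen := levelPen A n)
      (b := fun i => max (2 ^ (i + 1)) z₀) (w := fun i => levelPen A n i + levelPen A n i₀)
      (R := levelPen A n i₀) (ε := 1 / n) (Q := Q) i₀ (fun i => lt_max_of_lt_left (by positivity))
      (fun i x => ?_) (fun i => tailQ_anti s (le_max_right _ _)) (fun i => ?_)
      (sel := fun ω₂ => sel (ω₁, ω₂)) (fun ω₂ => hselε (ω₁, ω₂) i₀) hp).trans ?_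
    · obtain ⟨h1, h2⟩ := hbd i (k i ω₁) x
      obtain ⟨h3, h4⟩ := hbd i₀ (k i₀ ω₁) x
      rw [abs_le]
      constructor
      · linarith [le_max_right ((2 : ℝ) ^ (i + 1)) z₀]
      · linarith [le_max_left ((2 : ℝ) ^ (i + 1)) z₀]
    · have := sq_nonneg ‖G i (k i ω₁) - G i₀ (k i₀ ω₁)‖
      linarith
    · rw [← hn]
      have hT : 3 * ‖s - G i₀ (k i₀ ω₁)‖ ^ 2 + 2 * levelPen A n i₀ + 2 * levelPen A n i₀ +
          2 * (1 / n) + Q ≤ (3 + 128 * A) * (‖s - G i₀ (k i₀ ω₁)‖ ^ 2 + u + Q) := by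
        have e : levelPen A n i₀ = 32 * A * u := rfl
        rw [e]
        nlinarith [mul_nonneg hA.le (sq_nonneg ‖s - G i₀ (k i₀ ω₁)‖), mul_nonneg hA.le hQ0]
      have hsum : ∑' i : ℕ, ENNReal.ofReal (p ^ p * (32 * max (2 ^ (i + 1)) z₀ / n) ^ p *
          Real.exp (-(n * (levelPen A n i + levelPen A n i₀) / (32 * max (2 ^ (i + 1)) z₀)))) ≤
          ENNReal.ofReal (p ^ p) * 32 ^ p * ENNReal.ofReal u ^ p * r := by
        rw [hr, ← ENNReal.tsum_mul_left]
        refine ENNReal.tsum_le_tsum fun i => ?_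
        refine (ENNReal.ofReal_le_ofReal (level_weight_le hA hn0 hp i i₀)).trans ?_
        rw [ENNReal.ofReal_mul (by positivity), ENNReal.ofReal_mul (by positivity),
          ENNReal.ofReal_mul (by positivity), ENNReal.ofReal_pow (by positivity),
          ← ENNReal.ofReal_rpow_of_pos (show (0 : ℝ) < 32 by norm_num), ENNReal.ofReal_ofNat,
          ← ENNReal.ofReal_rpow_of_pos (show 0 < 2 ^ (i₀ + 1) / n by positivity)]
        gcongr
      have hA' : ENNReal.ofReal (3 * ‖s - G i₀ (k i₀ ω₁)‖ ^ 2 + 2 * levelPen A n i₀ +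
          2 * levelPen A n i₀ + 2 * (1 / n) + Q) ^ p ≤ ENNReal.ofReal (3 + 128 * A) ^ p * 4 ^ p *
          (‖s - G i₀ (k i₀ ω₁)‖ₑ ^ (2 * p) + ENNReal.ofReal u ^ p + ENNReal.ofReal Q ^ p) := by
        refine (ENNReal.rpow_le_rpow (ENNReal.ofReal_le_ofReal hT) hp.le).trans ?_
        rw [ENNReal.ofReal_mul (by positivity), ENNReal.ofReal_add (by positivity) hQ0,
          ENNReal.ofReal_add (by positivity) hu0.le, ENNReal.mul_rpow_of_nonneg _ _ hp.le,
          enorm_rpow_two_mul, mul_assoc]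
        gcongr
        exact add_add_rpow_le hp.le _ _ _
      set U := ‖s - G i₀ (k i₀ ω₁)‖ₑ ^ (2 * p) + ENNReal.ofReal u ^ p + ENNReal.ofReal Q ^ p
        with hU
      have hvU : ENNReal.ofReal u ^ p ≤ U := le_add_self.trans le_self_add
      calc _ ≤ 2 ^ p * (ENNReal.ofReal (3 + 128 * A) ^ p * 4 ^ p * U + 2 ^ p *
            (ENNReal.ofReal (p ^ p) * 32 ^ p * ENNReal.ofReal u ^ p * r)) := by gcongr
        _ ≤ 2 ^ p * (ENNReal.ofReal (3 + 128 * A) ^ p * 4 ^ p * U + 2 ^ p *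
            (ENNReal.ofReal (p ^ p) * 32 ^ p * U * r)) := by gcongr
        _ = selConst A p * U := by rw [selConst, ← hr]; ring
  have hm : Measurable fun ω : (ι₁ → X) × (ι₂ → X) =>
      ‖s - G (sel ω) (k (sel ω) ω.1)‖ₑ ^ (2 * p) :=
    (stronglyMeasurable_const.sub hest).enorm.pow_const _
  have hm₀ : Measurable fun ω : ι₁ → X => ‖s - G i₀ (k i₀ ω)‖ₑ ^ (2 * p) :=
    (Measurable.of_discrete (f := fun j : ℕ => ‖s - G i₀ j‖ₑ ^ (2 * p))).comp (hk i₀)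
  rw [lintegral_prod _ hm.aemeasurable]
  refine (lintegral_mono cond).trans (le_of_eq ?_)
  rw [lintegral_const_mul _ (by fun_prop), lintegral_add_right _ measurable_const,
    lintegral_add_right _ measurable_const]
  simp

lemma selConst_ne_top {A p : ℝ} (hp : 0 < p) (hAp : p * Real.log 2 < A) : selConst A p ≠ ⊤ := by
  have hr : ENNReal.ofReal (2 ^ p * Real.exp (-A)) < 1 := by
    rw [ENNReal.ofReal_lt_one, Real.rpow_def_of_pos (by norm_num), ← Real.exp_add,
      Real.exp_lt_one_iff]
    linarith
  have hs : ∑' i : ℕ, ENNReal.ofReal (2 ^ p * Real.exp (-A)) ^ (i + 1) ≠ ⊤ := by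
    simp_rw [pow_succ']
    rw [ENNReal.tsum_mul_left, ENNReal.tsum_geometric]
    exact ENNReal.mul_ne_top ENNReal.ofReal_ne_top
      (ENNReal.inv_ne_top.2 (tsub_pos_of_lt hr).ne')
  have h : ∀ x : ℝ≥0∞, x ≠ ⊤ → x ^ p ≠ ⊤ := fun x hx => ENNReal.rpow_ne_top_of_nonneg hp.le hx
  unfold selConst
  refine ENNReal.mul_ne_top (h _ (by simp)) (ENNReal.add_ne_top.2 ⟨ENNReal.mul_ne_top
    (h _ ENNReal.ofReal_ne_top) (h _ (by simp)), ENNReal.mul_ne_top (h _ (by simp))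
    (ENNReal.mul_ne_top (ENNReal.mul_ne_top ENNReal.ofReal_ne_top (h _ (by simp))) hs)⟩)

lemma levelConst_ne_top {p : ℝ} (hp : 0 < p) : levelConst p ≠ ⊤ := by
  have h : ∀ x : ℝ≥0∞, x ≠ ⊤ → x ^ p ≠ ⊤ := fun x hx => ENNReal.rpow_ne_top_of_nonneg hp.le hx
  unfold levelConst
  exact ENNReal.mul_ne_top (h _ (by simp)) (ENNReal.add_ne_top.2 ⟨h _ (by simp),
    ENNReal.mul_ne_top (ENNReal.mul_ne_top (by simp) ENNReal.ofReal_ne_top) (h _ (by simp))⟩)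

end LevelSelection

/-! ### Risk of the final estimator and bounded densities. -/

section Risk

variable {X : Type u} [MeasurableSpace X] {μ : Measure X}

/-- The constant in the risk bound of the final estimator. -/
noncomputable def riskConst (A p : ℝ) : ℝ≥0∞ :=
  selConst A p * (levelConst p * 18 ^ p + 18 ^ p + 1)

lemma riskConst_ne_top {A p : ℝ} (hp : 0 < p) (hAp : p * Real.log 2 < A) :
    riskConst A p ≠ ⊤ := by
  have h : (18 : ℝ≥0∞) ^ p ≠ ⊤ := ENNReal.rpow_ne_top_of_nonneg hp.le (by simp)
  exact ENNReal.mul_ne_top (selConst_ne_top hp hAp) (ENNReal.add_ne_top.2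
    ⟨ENNReal.add_ne_top.2 ⟨ENNReal.mul_ne_top (levelConst_ne_top hp) h, h⟩, by simp⟩)

/-- Needed to move the constant inside the infimum in `[0, ∞]`, where the value `⊤` occurs. -/
lemma riskConst_ne_zero {A p : ℝ} (hA : 0 < A) (hp : 0 < p) : riskConst A p ≠ 0 := by
  refine mul_ne_zero (mul_ne_zero (by simp [ENNReal.rpow_eq_zero_iff]) ?_) (by simp)
  have h1 : ENNReal.ofReal (3 + 128 * A) ≠ 0 := by simpa using by linarith
  have : ENNReal.ofReal (3 + 128 * A) ^ p * 4 ^ p ≠ 0 :=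
    mul_ne_zero (by simp [ENNReal.rpow_eq_zero_iff, h1, hp.not_gt])
      (by simp [ENNReal.rpow_eq_zero_iff])
  simp only [ne_eq, add_eq_zero, not_and]
  exact fun h => absurd h this

lemma exists_dyadic_level {z : ℝ} (hz : 2 ≤ z) :
    ∃ i : ℕ, z ≤ 2 ^ (i + 1) ∧ (2 : ℝ) ^ (i + 1) ≤ 2 * z ∧ (i + 1 : ℝ) ≤ 3 * Real.log z := by
  obtain ⟨i, h1, h2⟩ := exists_nat_pow_near (show 1 ≤ z by linarith) (show (1 : ℝ) < 2 by norm_num)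
  refine ⟨i, h2.le, by rw [pow_succ]; linarith, ?_⟩
  have h3 : (i : ℝ) * Real.log 2 ≤ Real.log z := by
    rw [← Real.log_pow]; exact Real.log_le_log (by positivity) h1
  have h4 : Real.log 2 ≤ Real.log z := Real.log_le_log (by norm_num) hz
  have h5 := Real.log_two_gt_d9
  have h6 : ((i : ℝ) + 1) * Real.log 2 ≤ 2 * Real.log z := by linarith
  have h7 : (0 : ℝ) ≤ i + 1 := by positivity
  nlinarith

lemma exists_estimator [IsProbabilityMeasure μ] {n : ℕ} (hn : 2 ≤ n) {M : Type v} [Countable M]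
    {S : M → Set (Lp ℝ 2 μ)} {D Δ : M → ℝ} {Sig : ℝ}
    (hD : ∀ m, 1 / 2 ≤ D m) (hS : ∀ m, HasMetricDimLE (S m) (D m))
    (hΔ : HasSum (fun m => Real.exp (-Δ m)) Sig) (hSig : 1 ≤ Sig) (A : ℝ) :
    ∃ est : (Fin n → X) → Lp ℝ 2 μ, StronglyMeasurable est ∧ (0 < A →
      ∀ s ∈ densitiesL2 μ, ∀ p : ℝ, 0 < p → ∀ z : ℝ, 2 ≤ z → ∀ m,
        risk μ n (2 * p) s est ≤ riskConst A p * ENNReal.ofReal Sig *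
          (Metric.infEDist s (S m) ^ (2 * p) +
            ENNReal.ofReal (z * max (max (D m) (Δ m)) (Real.log z) / n) ^ p +
            ENNReal.ofReal (tailQ μ s z) ^ p)) := by
  classical
  -- The nonpositive case only makes the estimator defined for every real `A`.
  rcases le_or_gt A 0 with hA | hA
  · exact ⟨fun _ => 0, stronglyMeasurable_const, fun h => absurd h hA.not_gt⟩
  -- Both parts have at least `n / 3` observations as soon as `n ≥ 2`.
  let P : Fin n → Prop := fun j => (j : ℕ) < n / 2
  have : Nonempty {j // P j} := ⟨⟨⟨0, by omega⟩, show 0 < n / 2 by omega⟩⟩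
  have : Nonempty {j // ¬ P j} := ⟨⟨⟨n / 2, by omega⟩, lt_irrefl (n / 2)⟩⟩
  have hc1 : Fintype.card {j // P j} = n / 2 := by
    rw [Fintype.card_subtype]
    exact (Fin.card_filter_val_lt).trans (min_eq_right (by omega))
  have hc2 : Fintype.card {j // ¬ P j} = n - n / 2 := by
    rw [Fintype.card_subtype_compl, hc1, Fintype.card_fin]
  choose G g k hg hG hbd hk hrisk using fun i : ℕ =>
    exists_level_estimator (μ := μ) (ι := {j // P j}) hD hS hΔ hSig
      (show (0 : ℝ) < 2 ^ (i + 1) by positivity)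
  obtain ⟨est, hest, hsel⟩ := exists_level_selection (ι₂ := {j // ¬ P j}) hg hG hbd hk hA
  refine ⟨fun ω => est (MeasurableEquiv.piEquivPiSubtypeProd (fun _ => X) P ω),
    hest.comp_measurable (MeasurableEquiv.measurable _), fun _ s hs p hp z hz m => ?_⟩
  have := isProbabilityMeasure_obsLaw hs
  obtain ⟨i, hi1, hi2, hi3⟩ := exists_dyadic_level hz
  have hmp := measurePreserving_piEquivPiSubtypeProd (fun _ : Fin n => obsLaw μ s) P
  have hm : Measurable fun ω => ‖s - est ω‖ₑ ^ (2 * p) :=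
    (stronglyMeasurable_const.sub hest).enorm.pow_const _
  rw [risk, sampleLaw, hmp.lintegral_comp hm]
  refine (hsel s hs p hp i).trans ?_
  have hn0 : (0 : ℝ) < n := by exact_mod_cast (by omega : 0 < n)
  set W := max (max (D m) (Δ m)) (Real.log z) with hW
  have hW0 : 0 ≤ max (D m) (Δ m) := le_max_of_le_left (by linarith [hD m])
  have hW1 : max (D m) (Δ m) ≤ W := le_max_left _ _
  have hW2 : Real.log z ≤ W := le_max_right _ _
  set v := z * W / n with hv
  have hv1 : 2 ^ (i + 1) * max (D m) (Δ m) / (Fintype.card {j // P j} : ℝ) ≤ 18 * v := by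
    have h1 : (n : ℝ) ≤ 3 * (Fintype.card {j // P j} : ℝ) := by
      rw [hc1]; exact_mod_cast (by omega : n ≤ 3 * (n / 2))
    have h0 : (0 : ℝ) < Fintype.card {j // P j} := by exact_mod_cast Fintype.card_pos
    rw [hv, div_le_iff₀ h0]
    have h2 : 2 ^ (i + 1) * max (D m) (Δ m) ≤ 2 * z * W := by gcongr
    have h3 : z * W ≤ z * W / n * (3 * (Fintype.card {j // P j} : ℝ)) := by
      rw [div_mul_eq_mul_div, le_div_iff₀ hn0]
      exact mul_le_mul_of_nonneg_left h1 (mul_nonneg (by linarith) (hW0.trans hW1))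
    have h4 : 0 ≤ z * W := mul_nonneg (by linarith) (hW0.trans hW1)
    linarith
  -- `18 = 3 · 2 · 3`: from `i + 1 ≤ 3 log z`, `2 ^ (i + 1) ≤ 2 z` and the sample size.
  have hv2 : (i + 1) * 2 ^ (i + 1) / (Fintype.card {j // ¬ P j} : ℝ) ≤ 18 * v := by
    have h1 : (n : ℝ) ≤ 3 * (Fintype.card {j // ¬ P j} : ℝ) := by
      rw [hc2]; exact_mod_cast (by omega : n ≤ 3 * (n - n / 2))
    have h0 : (0 : ℝ) < Fintype.card {j // ¬ P j} := by exact_mod_cast Fintype.card_pos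
    rw [hv, div_le_iff₀ h0]
    have h2 : ((i : ℝ) + 1) * 2 ^ (i + 1) ≤ 3 * W * (2 * z) := by
      have : 0 ≤ W := hW0.trans hW1
      gcongr
      linarith
    have h3 : z * W ≤ z * W / n * (3 * (Fintype.card {j // ¬ P j} : ℝ)) := by
      rw [div_mul_eq_mul_div, le_div_iff₀ hn0]
      exact mul_le_mul_of_nonneg_left h1 (mul_nonneg (by linarith) (hW0.trans hW1))
    linarith
  have hpow : ∀ x : ℝ, x ≤ 18 * v → ENNReal.ofReal x ^ p ≤ 18 ^ p * ENNReal.ofReal v ^ p := by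
    intro x hx
    rw [← ENNReal.mul_rpow_of_nonneg _ _ hp.le, ← ENNReal.ofReal_ofNat 18,
      ← ENNReal.ofReal_mul (by norm_num)]
    exact ENNReal.rpow_le_rpow (ENNReal.ofReal_le_ofReal hx) hp.le
  have h18 : (1 : ℝ≥0∞) ≤ 18 ^ p := ENNReal.one_le_rpow (by norm_num) hp
  have hQ : ENNReal.ofReal (tailQ μ s (2 ^ (i + 1))) ^ p ≤ ENNReal.ofReal (tailQ μ s z) ^ p :=
    ENNReal.rpow_le_rpow (ENNReal.ofReal_le_ofReal (tailQ_anti s hi1)) hp.le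
  have hSig' : (1 : ℝ≥0∞) ≤ ENNReal.ofReal Sig := by simpa using hSig
  set E := Metric.infEDist s (S m) ^ (2 * p)
  set V := ENNReal.ofReal v ^ p
  set Q := ENNReal.ofReal (tailQ μ s z) ^ p
  have hlevel := (hrisk i s hs p hp m).trans (mul_le_mul_right
    (show _ ≤ 18 ^ p * (E + V + Q) by
      rw [mul_add, mul_add]
      exact add_le_add (add_le_add (le_mul_of_one_le_left zero_le h18) (hpow _ hv1))
        (hQ.trans (le_mul_of_one_le_left zero_le h18))) _)
  calc _ ≤ selConst A p * (levelConst p * ENNReal.ofReal Sig * (18 ^ p * (E + V + Q)) +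
        18 ^ p * V + Q) :=
        mul_le_mul_right (add_le_add (add_le_add hlevel (hpow _ hv2)) hQ) _
    _ ≤ selConst A p * (levelConst p * ENNReal.ofReal Sig * (18 ^ p * (E + V + Q)) +
        18 ^ p * (ENNReal.ofReal Sig * (E + V + Q)) + ENNReal.ofReal Sig * (E + V + Q)) := by
        gcongr
        · exact le_mul_of_one_le_of_le hSig' (le_add_self.trans le_self_add)
        · exact le_mul_of_one_le_of_le hSig' le_add_self
    _ = riskConst A p * ENNReal.ofReal Sig * (E + V + Q) := by rw [riskConst]; ring

lemma ae_le_supNorm {s : Lp ℝ 2 μ} (h : MemLp s ∞ μ) : ∀ᵐ x ∂μ, s x ≤ supNorm μ s := by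
  filter_upwards [ae_le_eLpNormEssSup (f := s) (μ := μ)] with x hx
  rw [← eLpNorm_exponent_top] at hx
  refine (le_abs_self _).trans ?_
  rw [supNorm, ← Real.norm_eq_abs, ← toReal_enorm]
  exact ENNReal.toReal_mono h.2.ne hx

lemma one_le_supNorm [IsProbabilityMeasure μ] {s : Lp ℝ 2 μ} (hs : s ∈ densitiesL2 μ)
    (h : MemLp s ∞ μ) : 1 ≤ supNorm μ s := by
  have := integral_mono_ae (integrable_density s) (integrable_const (supNorm μ s)) (ae_le_supNorm h)
  rw [hs.2] at this
  simpa using this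

lemma tailQ_eq_zero {s : Lp ℝ 2 μ} (h : MemLp s ∞ μ) {z : ℝ} (hz : supNorm μ s ≤ z) :
    tailQ μ s z = 0 := by
  rw [tailQ_eq]
  refine integral_eq_zero_of_ae ?_
  filter_upwards [ae_le_supNorm h] with x hx
  simp [max_eq_right (show s x - z ≤ 0 by linarith)]

end Risk

end DensityEstimation

/-! ### Assembly of the two risk bounds. -/

theorem mainTheorem1 :
    ∃ (C : ℝ → ℝ → ℝ≥0) (C₁ : ℝ≥0),
      ∀ (X : Type u) [MeasurableSpace X] (μ : Measure X) [IsProbabilityMeasure μ]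
        (n : ℕ) (_hn : 2 ≤ n)
        (M : Type v) [Countable M]
        (S : M → Set (Lp ℝ 2 μ)) (D Δ : M → ℝ) (Sig : ℝ)
        (_hD : ∀ m, 1 / 2 ≤ D m)
        (_hS : ∀ m, DensityEstimation.HasMetricDimLE (S m) (D m))
        (_hΔ : HasSum (fun m => Real.exp (-Δ m)) Sig) (_hSig : 1 ≤ Sig),
        ∃ est : ℝ → (Fin n → X) → Lp ℝ 2 μ,
          (∀ A : ℝ, 1 ≤ A →
            StronglyMeasurable (est A) ∧
            ∀ s ∈ DensityEstimation.densitiesL2 μ, ∀ q : ℝ, 1 ≤ q → q < 2 * A / Real.log 2 →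
              DensityEstimation.risk μ n q s (est A) ≤
                (C A q : ℝ≥0∞) * ENNReal.ofReal Sig *
                  ⨅ (z : ℝ) (_ : 2 ≤ z) (m : M),
                    (Metric.infEDist s (S m) ^ q
                      + ENNReal.ofReal
                          ((z * max (max (D m) (Δ m)) (Real.log z) / (n : ℝ)) ^ (q / 2))
                      + ENNReal.ofReal (DensityEstimation.tailQ μ s z ^ (q / 2)))) ∧
          (∀ s ∈ DensityEstimation.densitiesL2 μ, MemLp s ∞ μ →
            DensityEstimation.risk μ n 2 s (est 1) ≤
              (C₁ : ℝ≥0∞) * ENNReal.ofReal Sig *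
                ⨅ m : M,
                  (Metric.infEDist s (S m) ^ (2 : ℝ)
                    + ENNReal.ofReal
                        (DensityEstimation.supNorm μ s
                          * max (max (D m) (Δ m)) (Real.log (DensityEstimation.supNorm μ s))
                          / (n : ℝ)))) := by
  -- `toNNReal` sends `⊤` to `0`, harmlessly: the constant is finite when `q < 2 A / log 2`.
  refine ⟨fun A q => (DensityEstimation.riskConst A (q / 2)).toNNReal,
    (DensityEstimation.riskConst 1 1 * 4).toNNReal, ?_⟩
  intro X _ μ _ n hn M _ S D Δ Sig hD hS hΔ hSig
  choose est hest hrisk using DensityEstimation.exists_estimator hn hD hS hΔ hSig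
  have hSig0 : ENNReal.ofReal Sig ≠ 0 := by simpa using by linarith
  have hlog := Real.log_pos one_lt_two
  refine ⟨est, fun A hA => ⟨hest A, fun s hs q hq hqA => ?_⟩, fun s hs hsup => ?_⟩
  · have hp : 0 < q / 2 := by linarith
    have hqA' : q / 2 * Real.log 2 < A := by
      rw [lt_div_iff₀ hlog] at hqA; linarith
    rw [ENNReal.coe_toNNReal (DensityEstimation.riskConst_ne_top hp hqA')]
    have hk0 := mul_ne_zero (DensityEstimation.riskConst_ne_zero (by linarith : 0 < A) hp) hSig0
    have hkt := ENNReal.mul_ne_top (DensityEstimation.riskConst_ne_top hp hqA')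
      (ENNReal.ofReal_ne_top (r := Sig))
    simp_rw [ENNReal.mul_iInf_of_ne hk0 hkt]
    refine le_iInf fun z => le_iInf fun hz => le_iInf fun m => ?_
    have h := hrisk A (by linarith) s hs (q / 2) hp z hz m
    rw [mul_div_cancel₀ q two_ne_zero] at h
    have hW : 0 ≤ max (max (D m) (Δ m)) (Real.log z) :=
      le_max_of_le_left (le_max_of_le_left (by linarith [hD m]))
    rwa [ENNReal.ofReal_rpow_of_nonneg (by positivity) hp.le,
      ENNReal.ofReal_rpow_of_nonneg (DensityEstimation.tailQ_nonneg s z) hp.le] at h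
  · have h1 : (1 : ℝ) * Real.log 2 < 1 := by linarith [Real.log_two_lt_d9]
    have hc := DensityEstimation.riskConst_ne_top one_pos h1
    have hc4 := ENNReal.mul_ne_top hc (show (4 : ℝ≥0∞) ≠ ⊤ by simp)
    rw [ENNReal.coe_toNNReal hc4, ENNReal.mul_iInf_of_ne (mul_ne_zero (mul_ne_zero
      (DensityEstimation.riskConst_ne_zero one_pos one_pos) (by simp)) hSig0)
      (ENNReal.mul_ne_top hc4 ENNReal.ofReal_ne_top)]
    refine le_iInf fun m => ?_
    set b := DensityEstimation.supNorm μ s with hb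
    have hb1 : 1 ≤ b := DensityEstimation.one_le_supNorm hs hsup
    -- At this level `Q_s` vanishes. Since `b ≥ 1` and `D ≥ 1/2`, replacing `max b 2` by `b` costs a
    -- factor 2 in the level and another in the logarithmic term, hence 4.
    have h := hrisk 1 one_pos s hs 1 one_pos (max b 2) (le_max_right _ _) m
    rw [DensityEstimation.tailQ_eq_zero hsup (le_max_left _ _), ENNReal.ofReal_zero,
      ENNReal.zero_rpow_of_pos one_pos, add_zero, ENNReal.rpow_one, mul_one] at h
    refine h.trans ?_
    have hn0 : (0 : ℝ) < n := by exact_mod_cast (by omega : 0 < n)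
    set W := max (max (D m) (Δ m)) (Real.log b) with hW
    have hDW : D m ≤ W := (le_max_left _ _).trans (le_max_left _ _)
    have hW0 : 0 < W := by linarith [hD m]
    have hz : max b 2 ≤ 2 * b := max_le (by linarith) (by linarith)
    have hlogz : max (max (D m) (Δ m)) (Real.log (max b 2)) ≤ 2 * W := by
      have h2 : max (D m) (Δ m) ≤ W := le_max_left _ _
      have h3 : Real.log b ≤ W := le_max_right _ _
      refine max_le (by linarith) ?_
      rcases max_choice b 2 with h | h <;> rw [h]
      · linarith
      · linarith [hD m]
    have hv : max b 2 * max (max (D m) (Δ m)) (Real.log (max b 2)) / n ≤ 4 * (b * W / n) := by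
      rw [← mul_div_assoc]
      refine div_le_div_of_nonneg_right ?_ hn0.le
      calc _ ≤ 2 * b * (2 * W) := mul_le_mul hz hlogz
            (le_max_of_le_left (le_max_of_le_left (by linarith [hD m]))) (by linarith)
        _ = _ := by ring
    calc _ ≤ DensityEstimation.riskConst 1 1 * ENNReal.ofReal Sig *
          (4 * Metric.infEDist s (S m) ^ (2 : ℝ) + 4 * ENNReal.ofReal (b * W / n)) := by
          gcongr
          · exact le_mul_of_one_le_left zero_le (by norm_num)
          · rw [← ENNReal.ofReal_ofNat 4, ← ENNReal.ofReal_mul (by norm_num)]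
            exact ENNReal.ofReal_le_ofReal hv
      _ = _ := by ring
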